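/- Let $n,k,t$ be integers with $1\le k\le n$ and $t\ge 0$, and let $\lambda,\mu>0$. The $M^k/M/n(t)$ queue has $n$ identical servers and a common buffer of infinite capacity. Batches of $k$ jobs arrive as a Poisson process of rate $\lambda$, all service times are independent, exponentially distributed with rate $\mu$ and independent of the arrivals, and at time $0$ there are no jobs in the system. A batch is called waiting if at least one of its jobs is in the buffer (has not begun service); the waiting batches are ordered by arrival. The scheduling policy is the following (whenever jobs of one batch are assigned to idle servers, as many as possible are assigned, to distinct servers, which are chosen by an arbitrary rule that may depend on the current configuration of the servers and the buffer). * On arrival of a batch: if fewer than $t$ batches are waiting, or none, jobs of the new batch are assigned to the idle servers. If exactly $t\ge 1$ batches are waiting, jobs of the first waiting batch are assigned to the idle servers (whether or not these have already served that batch), and if this clears the batch from the buffer then jobs of the new batch are assigned to the remaining idle servers. In all cases the remaining jobs of the new batch are appended to the end of the buffer. * On departure of a job from a server $s$: if strictly more than $t$ batches are waiting, a job of the first waiting batch is assigned to $s$. Otherwise a job of the earliest waiting batch none of whose jobs has been served by $s$ is assigned to $s$; if there is no such batch, $s$ becomes idle. Let $m$ be the number of jobs in the system (in service or in the buffer), and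 for $1\le i\le t$ let $w_i$ be the number of jobs of the $i$-th waiting batch that are in the buffer ($w_i=0$ if there is no such batch). Theorem. There is a matrix $Q$, depending only on $n,k,t,\lambda,\mu$, such that for every such queue the process $(w_1,\dots,w_t,m)$ is a continuous-time Markov chain on $\{0,\dots,k\}^t\times\{0,1,2,\dots\}$ with generator $Q$ and initial state $(0,\dots,0,0)$. Moreover $Q$ is the generator of a quasi-birth-death process with the set of boundary states $\{0,\dots,k\}^t\times\{0,\dots,n+tk\}$ and the levels $\{0,\dots,k\}^t\times\{n-k+1+jk,\dots,n+jk\}$, $j=t+1,t+2,\dots$. That is, the boundary and the levels partition the state space and, if the levels are identified with each other by the shifts $(w,m)\mapsto(w,m+k)$, then $Q$ has the block form $$\begin{bmatrix} B_1&B_2&0&0&\cdots\\ B_0&A_1&A_2&0&\cdots\\ 0&A_0&A_1&A_2&\cdots\\ 0&0&A_0&A_1&\cdots\\ \vdots&\vdots&\vdots&\vdots&\ddots\end{bmatrix}$$ with respect to the boundary and the successive levels. -/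

import Mathlib

open MeasureTheory ProbabilityTheory
open scoped ENNReal NNReal

/-! ## Continuous-time Markov chains and quasi-birth-death processes -/

namespace MkMn

/-- The rate at which a chain with generator `Q` leaves the state `x`. -/
def exitRate {S : Type*} (Q : Matrix S S ℝ) (x : S) : ℝ := -Q x x

open Classical in
/-- The transition matrix of the jump chain of `Q`; a state with exit rate `0` is absorbing. -/
noncomputable def jumpMatrix {S : Type*} (Q : Matrix S S ℝ) : Matrix S S ℝ := fun x y =>
  if exitRate Q x = 0 then (if x = y then 1 else 0)
  else if x = y then 0 else Q x y / exitRate Q x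

/-- `Q` is the generator of a continuous-time Markov chain: nonnegative rates off the diagonal,
and rows that sum to zero. -/
structure IsGenerator {S : Type*} (Q : Matrix S S ℝ) : Prop where
  nonneg : ∀ x y, x ≠ y → 0 ≤ Q x y
  row_sum : ∀ x, HasSum (fun y => Q x y) 0

open Classical in
/-- The process `X` on the countable set `S` is a continuous-time Markov chain with generator `Q`
that starts at `x₀` (jump chain and holding times): it visits the successive states
`Y 0, Y 1, …` and stays in them for the successive times `H 0, H 1, …`, where `Y` is a Markov chain
with transition matrix `jumpMatrix Q` started at `x₀` and, given `Y`, the `H i` are independent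
and exponentially distributed with the parameters `exitRate Q (Y i)` (infinite when that
parameter is `0`). As usual this describes `X` up to the explosion time `∑ i, H i`, which
is almost surely infinite when the exit rates are bounded. -/
def IsMarkovChain {Ω S : Type*} [MeasurableSpace Ω] (P : Measure Ω) (Q : Matrix S S ℝ) (x₀ : S)
    (X : ℝ≥0 → Ω → S) : Prop :=
  ∃ (Y : ℕ → Ω → S) (H : ℕ → Ω → ℝ≥0∞),
    (∀ i y, MeasurableSet (Y i ⁻¹' {y})) ∧ (∀ i, Measurable (H i)) ∧
    (∀ (N : ℕ) (y : ℕ → S) (s : ℕ → ℝ≥0),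
      P {ω | (∀ i ≤ N, Y i ω = y i) ∧ ∀ i < N, (s i : ℝ≥0∞) < H i ω} =
        ENNReal.ofReal ((if y 0 = x₀ then 1 else 0) *
          ∏ i ∈ Finset.range N,
            (Real.exp (-(exitRate Q (y i) * (s i : ℝ))) * jumpMatrix Q (y i) (y (i + 1))))) ∧
    (∀ᵐ ω ∂P, ∀ (N : ℕ) (τ : ℝ≥0),
      (∑ i ∈ Finset.range N, H i ω) ≤ τ → (τ : ℝ≥0∞) < ∑ i ∈ Finset.range (N + 1), H i ω →
        X τ ω = Y N ω)

/-- The block-tridiagonal matrix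
`[B₁ B₂ 0 0 ⋯; B₀ A₁ A₂ 0 ⋯; 0 A₀ A₁ A₂ ⋯; 0 0 A₀ A₁ ⋯; ⋯]`. The index `Sum.inl b` is a boundary
state and `Sum.inr (i, l)` is the state `l` of the level number `i = 0, 1, 2, …`. -/
def qbdMatrix {B L : Type*} (B₀ : Matrix L B ℝ) (B₁ : Matrix B B ℝ) (B₂ : Matrix B L ℝ)
    (A₀ A₁ A₂ : Matrix L L ℝ) : Matrix (B ⊕ ℕ × L) (B ⊕ ℕ × L) ℝ
  | Sum.inl b, Sum.inl b' => B₁ b b'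
  | Sum.inl b, Sum.inr (j, l') => if j = 0 then B₂ b l' else 0
  | Sum.inr (i, l), Sum.inl b' => if i = 0 then B₀ l b' else 0
  | Sum.inr (i, l), Sum.inr (j, l') =>
      if i = j + 1 then A₀ l l' else if i = j then A₁ l l' else if j = i + 1 then A₂ l l' else 0

/-- `Q` is the generator of a quasi-birth-death process with the given finite set of boundary
states and the given levels `level 0, level 1, …`, which partition the state space. The map
`phase i` enumerates the level number `i` by the common finite index set `L`; with respect to
these enumerations `Q` has the form `qbdMatrix`. -/
structure IsQBD {S L : Type*} (Q : Matrix S S ℝ) (boundary : Set S) (level : ℕ → Set S)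
    (phase : ℕ → L → S) : Prop where
  generator : IsGenerator Q
  boundary_finite : boundary.Finite
  phase_finite : Finite L
  phase_injective : ∀ i, Function.Injective (phase i)
  phase_range : ∀ i, Set.range (phase i) = level i
  boundary_disjoint : ∀ i, Disjoint boundary (level i)
  level_disjoint : ∀ i j, i ≠ j → Disjoint (level i) (level j)
  cover : boundary ∪ ⋃ i, level i = Set.univ
  blocks : ∃ (B₀ : Matrix L boundary ℝ) (B₁ : Matrix boundary boundary ℝ)
    (B₂ : Matrix boundary L ℝ) (A₀ A₁ A₂ : Matrix L L ℝ),
    let e : boundary ⊕ ℕ × L → S := Sum.elim Subtype.val (fun p => phase p.1 p.2)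
    Q.submatrix e e = qbdMatrix B₀ B₁ B₂ A₀ A₁ A₂

/-! ## The scheduling policy -/

/-- A batch some of whose `k` jobs are waiting in the buffer: the number of its waiting jobs, and
the set of servers that have served, or are serving, a job of the batch. -/
structure Batch (n k : ℕ) where
  waiting : ℕ
  waiting_le : waiting ≤ k
  served : Finset (Fin n)

/-- A configuration of the system: the set of busy servers, and the waiting batches, the
earliest arrival first. -/
structure Config (n k : ℕ) where
  busy : Finset (Fin n)
  buffer : List (Batch n k)

/-- A rule that decides which idle servers receive jobs: when `j` jobs of one batch are to be
assigned to the idle servers in `I`, as many as possible of them are assigned, to the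
distinct servers in `pick c I j`. The choice may depend on the configuration `c`. -/
structure AssignmentRule (n k : ℕ) where
  pick : Config n k → Finset (Fin n) → ℕ → Finset (Fin n)
  pick_subset : ∀ c I j, pick c I j ⊆ I
  card_pick : ∀ c I j, (pick c I j).card = min j I.card

variable {n k : ℕ}

/-- A batch that has just arrived. -/
def Batch.new : Batch n k := ⟨k, le_rfl, ∅⟩

/-- Assign one job of the batch to each server in `U`. -/
def Batch.assign (b : Batch n k) (U : Finset (Fin n)) : Batch n k :=
  ⟨b.waiting - U.card, (Nat.sub_le _ _).trans b.waiting_le, b.served ∪ U⟩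

/-- Append the batch at the end of the buffer if it has waiting jobs. -/
def enqueue (q : List (Batch n k)) (b : Batch n k) : List (Batch n k) :=
  if b.waiting = 0 then q else q ++ [b]

/-- Put the batch at the head of the buffer if it has waiting jobs. -/
def requeue (b : Batch n k) (q : List (Batch n k)) : List (Batch n k) :=
  if b.waiting = 0 then q else b :: q

/-- The idle servers. -/
def Config.idle (c : Config n k) : Finset (Fin n) := c.busyᶜ

/-- Arrival of a batch. If fewer than `t` batches are waiting, or none, jobs of the new batch are
assigned to the idle servers. If exactly `t ≥ 1` batches are waiting, jobs of the first of them are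
assigned to the idle servers, without any restriction, and if this clears it from the
buffer then jobs of the new batch are assigned to the remaining idle servers. The remaining jobs of
the new batch go to the end of the buffer. -/
def Config.arrive (t : ℕ) (rule : AssignmentRule n k) (c : Config n k) : Config n k :=
  match c.buffer with
  | [] =>
      let U := rule.pick c c.idle k
      ⟨c.busy ∪ U, enqueue [] (Batch.new.assign U)⟩
  | b :: rest =>
      if c.buffer.length < t then
        let U := rule.pick c c.idle k
        ⟨c.busy ∪ U, enqueue c.buffer (Batch.new.assign U)⟩
      else if c.buffer.length = t then
        let U := rule.pick c c.idle b.waiting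
        if (b.assign U).waiting = 0 then
          let V := rule.pick c (c.idle \ U) k
          ⟨c.busy ∪ U ∪ V, enqueue rest (Batch.new.assign V)⟩
        else ⟨c.busy ∪ U, enqueue (b.assign U :: rest) Batch.new⟩
      else ⟨c.busy, enqueue c.buffer Batch.new⟩

/-- Assign to the server `s` a job of the earliest batch that it may serve, if there is one: any
batch if `relaxed` is true, and otherwise a batch that `s` has not served. -/
def serveFirst (relaxed : Bool) (s : Fin n) : List (Batch n k) → Option (List (Batch n k))
  | [] => none
  | b :: rest =>
      if relaxed = true ∨ s ∉ b.served then some (requeue (b.assign {s}) rest)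
      else (serveFirst relaxed s rest).map (fun q => b :: q)

/-- Departure of a job from the busy server `s`: if strictly more than `t` batches are waiting, `s`
takes a job of the first one; otherwise `s` takes a job of the earliest waiting batch that it has
not served, and becomes idle if there is none. -/
def Config.depart (t : ℕ) (s : Fin n) (c : Config n k) : Config n k :=
  match serveFirst (decide (t < c.buffer.length)) s c.buffer with
  | none => ⟨c.busy.erase s, c.buffer⟩
  | some q => ⟨c.busy, q⟩

/-! ## The queue driven by exponential clocks -/

/-- An event: `none` is the arrival of a batch, `some s` is a departure from the server `s`. -/
abbrev Event (n : ℕ) := Option (Fin n)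

/-- The configuration after the event. -/
def Config.next (t : ℕ) (rule : AssignmentRule n k) (c : Config n k) : Event n → Config n k
  | none => c.arrive t rule
  | some s => c.depart t s

/-- The system just after an event: its configuration, the time left until the next arrival
(`clock none`), and for each busy server `s` the remaining service time of the job at `s`
(`clock (some s)`). The clocks of the idle servers are not running and have no meaning. -/
structure Snapshot (n k : ℕ) where
  config : Config n k
  clock : Event n → ℝ

/-- The clocks that are running: the arrival clock and those of the busy servers. -/
def Snapshot.running (x : Snapshot n k) : Finset (Event n) := Finset.insertNone x.config.busy

open Classical in
/-- The next event: the one whose clock is the smallest running clock. (Ties, which have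
probability zero, go to the server with the smallest number.) -/
noncomputable def Snapshot.firing (x : Snapshot n k) : Event n :=
  (List.finRange n).find? fun s =>
    decide (s ∈ x.config.busy ∧ ∀ f ∈ x.running, x.clock (some s) ≤ x.clock f)

/-- The time until the next event. -/
noncomputable def Snapshot.holding (x : Snapshot n k) : ℝ := x.clock x.firing

open Classical in
/-- The system after the next event. A clock that has fired or was not running is set to
a fresh sample; the other clocks keep running. -/
noncomputable def Snapshot.step (t : ℕ) (rule : AssignmentRule n k) (fresh : Event n → ℝ)
    (x : Snapshot n k) : Snapshot n k where
  config := x.config.next t rule x.firing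
  clock f := if f = x.firing ∨ f ∉ x.running then fresh f else x.clock f - x.holding

/-- The system after its first `N` events, started without any jobs. The number `ξ i none`
is the interarrival time that starts at the event number `i` (if that is an arrival, or `i = 0`), and
`ξ i (some s)` is the service time of the job that the server `s` starts at the event number `i`
(if it starts one). -/
noncomputable def snapshot (t : ℕ) (rule : AssignmentRule n k) (ξ : ℕ → Event n → ℝ) :
    ℕ → Snapshot n k
  | 0 => ⟨⟨∅, []⟩, ξ 0⟩
  | N + 1 => (snapshot t rule ξ N).step t rule (ξ (N + 1))

/-- The time of the event number `N`; time `0` for `N = 0`. -/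
noncomputable def eventTime (t : ℕ) (rule : AssignmentRule n k) (ξ : ℕ → Event n → ℝ) (N : ℕ) :
    ℝ≥0∞ :=
  ∑ i ∈ Finset.range N, ENNReal.ofReal (snapshot t rule ξ i).holding

/-- The configuration at time `τ`: the one after all the events up to time `τ`. -/
noncomputable def configAt (t : ℕ) (rule : AssignmentRule n k) (ξ : ℕ → Event n → ℝ) (τ : ℝ≥0) :
    Config n k :=
  (snapshot t rule ξ (sSup {N | eventTime t rule ξ N ≤ τ})).config

/-- The primitive random variables of the queue are mutually independent, with
interarrival times exponential of rate `lam` (so that the batches arrive as a Poisson process)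
and service times exponential of rate `mu`. -/
structure IsInput {Ω : Type*} [MeasurableSpace Ω] (P : Measure Ω) (lam mu : ℝ)
    (ξ : ℕ → Event n → Ω → ℝ) : Prop where
  measurable : ∀ i f, Measurable (ξ i f)
  indep : iIndepFun (fun p : ℕ × Event n => ξ p.1 p.2) P
  interarrival : ∀ i, P.map (ξ i none) = expMeasure lam
  service : ∀ i s, P.map (ξ i (some s)) = expMeasure mu

/-! ## The reduced state -/

/-- The set `{0, …, k}^t × {0, 1, 2, …}` of the states `(w₁, …, w_t, m)`. -/
abbrev QState (k t : ℕ) := (Fin t → Fin (k + 1)) × ℕ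

/-- The reduced state of a configuration: `w_i` is the number of waiting jobs of the `i`-th waiting
batch (`0` if there is no such batch), for `i = 1, …, t`, and `m` is the number of jobs in
the system, in service or waiting. -/
def Config.state (t : ℕ) (c : Config n k) : QState k t :=
  (fun i => match c.buffer[(i : ℕ)]? with
    | none => 0
    | some b => ⟨b.waiting, Nat.lt_succ_of_le b.waiting_le⟩,
   c.busy.card + (c.buffer.map Batch.waiting).sum)

/-- `{0, …, k}^t × {0, …, n + t k}`. -/
def boundary (n k t : ℕ) : Set (QState k t) := {x | x.2 ≤ n + t * k}

/-- `{0, …, k}^t × {n - k + 1 + j k, …, n + j k}`. -/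
def level (n k t j : ℕ) : Set (QState k t) := {x | n - k + 1 + j * k ≤ x.2 ∧ x.2 ≤ n + j * k}

/-- The enumeration of `level n k t j` in which `(w, r)` is the state `w` with
`n - k + 1 + j k + r` jobs. -/
def levelState (n k t j : ℕ) (x : (Fin t → Fin (k + 1)) × Fin k) : QState k t :=
  (x.1, n - k + 1 + j * k + x.2)

end MkMn

/-! Why `(w, m)` suffices. The arbitrary choice of servers is invisible in the reduced state because
of the shape of the reachable configurations (`Config.Good`). The served sets of the waiting batches
are nested, those of earlier batches being larger, and they contain all idle servers: a new batch
that leaves jobs in the buffer while fewer than `t` batches wait has taken every idle server, a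
freed server turns to the earliest batch it has not served, and it becomes idle only if it has
served them all. While at most `t` batches wait, the served set of the `i`-th one has `k - w_i`
elements. Hence the number of busy servers that have served exactly the first `i` waiting batches is
a difference of consecutive sizes in a chain from all `n` servers down to the idle ones, and is a
function of `w` and `m` (`card_filter_depth`).

If more than `t` batches wait, all servers are busy and every departure takes a job of the first
batch, at total rate `n * mu`. The batches beyond the recorded ones are untouched (for `t = 0`,
those beyond the first), so the entry that comes into view when the first batch clears is `k`. The
first batch may now be served repeatedly by one server, which spoils the size of its served set; but
the number of waiting batches can fall back to `t` only when this batch leaves the buffer. The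
inequality `m > n + ∑ w_i` tells the two modes apart (`Config.Good.saturated_iff`). So the total
rate from a configuration to a given reduced state depends only on the present reduced state: the
configuration process is lumpable (`Config.Good.generator_state`).

Probability enters through the race of exponential clocks. By memorylessness, whichever clock fires
and whenever it fires, the residual clocks together with the fresh samples are again independent
exponentials, independent of the winner and of the firing time (`clockLaw_prod_residual`). By
induction on the events, given the reduced history and the present configuration, the clocks have
the law `clockLaw` (`IsInput.measure_history_inter_clock`). Summing over the configurations with the
same reduced state then gives the product formula for the jump chain and the holding times.

For the block form, `m > n + t * k` forces saturation whatever `w` is. There the rates are invariant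
under shifts of `m`, and `m` moves only by `+k` or `-1`. A level consists of `k` consecutive values
of `m`, so no jump skips a level. -/

namespace MkMn

variable {n k t : ℕ}

/-! ## The reduced state as a list -/

/-- The nonzero entries of `w₁, …, w_t`. -/
def counts (x : QState k t) : List ℕ := (List.ofFn fun i => (x.1 i : ℕ)).filter (· ≠ 0)

/-- The state with `m` jobs whose components `w₁, …, w_t` are the first entries of `l`, followed by
zeros. -/
def pack (t : ℕ) (l : List ℕ) (m : ℕ) : QState k t :=
  (fun i => ⟨min (l.getD i 0) k, Nat.lt_succ_of_le (min_le_right _ _)⟩, m)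

/-- The numbers of waiting jobs of the waiting batches. -/
def Config.counts (c : Config n k) : List ℕ := c.buffer.map Batch.waiting

/-- The number of jobs in the system. -/
def Config.jobs (c : Config n k) : ℕ := c.busy.card + c.counts.sum

theorem Config.state_eq_pack (c : Config n k) : c.state t = pack t c.counts c.jobs := by
  refine Prod.ext (funext fun i => Fin.ext ?_) rfl
  simp only [Config.state, pack, Config.counts, List.getD_eq_getElem?_getD, List.getElem?_map]
  cases c.buffer[(i : ℕ)]? with
  | none => simp
  | some b => simp [b.waiting_le]

/-- Deleting zeros undoes the padding in `pack` because the genuine entries are nonzero, and the cap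
at `k` is inactive. -/
theorem counts_pack (l : List ℕ) (m : ℕ) (hl : ∀ a ∈ l, a ≠ 0 ∧ a ≤ k) :
    counts (pack t l m : QState k t) = l.take t := by
  unfold counts pack
  induction t generalizing l with
  | zero => simp
  | succ t ih =>
    cases l with
    | nil =>
      simp [List.ofFn_succ]
    | cons a l =>
      have := ih l (fun b hb => hl b (by simp [hb]))
      have ha := hl a (by simp)
      simp only [List.ofFn_succ]
      simp_all

theorem pack_append {A B : List ℕ} (m : ℕ) (h : t ≤ A.length) :
    (pack t (A ++ B) m : QState k t) = pack t A m := by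
  refine Prod.ext (funext fun i => Fin.ext ?_) rfl
  have : (i : ℕ) < A.length := i.2.trans_le h
  simp [pack, List.getElem?_append_left this]

/-! ## The transitions of the reduced state -/

/-- The list `[a]`, or the empty list if `a = 0`. -/
def nonzeroSingleton (a : ℕ) : List ℕ := if a = 0 then [] else [a]

/-- Decrease the entry number `i`, and remove it if it becomes zero. -/
def decAt : List ℕ → ℕ → List ℕ
  | [], _ => []
  | b :: l, 0 => nonzeroSingleton (b - 1) ++ l
  | b :: l, i + 1 => b :: decAt l i

/-- More than `t` batches are waiting. -/
def Saturated (n : ℕ) (x : QState k t) : Prop := n + (counts x).sum < x.2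

instance (x : QState k t) : Decidable (Saturated n x) := by unfold Saturated; infer_instance

/-- The number of idle servers when at most `t` batches are waiting. -/
def idleCount (n : ℕ) (x : QState k t) : ℕ := n - (x.2 - (counts x).sum)

/-- The waiting jobs after an arrival when at most `t` batches with `l` jobs are waiting and
`I` servers are idle. -/
def arriveCounts (k t I : ℕ) (l : List ℕ) : List ℕ :=
  match l with
  | [] => nonzeroSingleton (k - I)
  | b :: rest =>
    if rest.length + 1 < t then b :: rest ++ nonzeroSingleton (k - I)
    else if b ≤ I then rest ++ nonzeroSingleton (k - (I - b))
    else (b - I) :: rest ++ [k]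

/-- The state after an arrival. -/
def arriveState (n : ℕ) (x : QState k t) : QState k t :=
  if Saturated n x then (x.1, x.2 + k)
  else pack t (arriveCounts k t (idleCount n x) (counts x)) (x.2 + k)

/-- The waiting jobs of the first `t` batches after a departure when more than `t` are waiting. -/
def relaxedCounts (k : ℕ) : List ℕ → List ℕ
  | [] => []
  | b :: l => nonzeroSingleton (b - 1) ++ l ++ [k]

/-- The state after the departure from a server that has served exactly the first `i` of
the waiting batches. -/
def departState (n : ℕ) (x : QState k t) (i : ℕ) : QState k t :=
  if Saturated n x then pack t (relaxedCounts k (counts x)) (x.2 - 1)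
  else pack t (decAt (counts x) i) (x.2 - 1)

/-- Among `p` servers that have served all earlier batches, the number of busy ones that
have served exactly the first `i` of the batches with the waiting jobs `l`, if `I` servers are
idle. -/
def stageCount (k I : ℕ) : ℕ → List ℕ → ℕ → ℕ
  | p, [], i => if i = 0 then p - I else 0
  | p, b :: _, 0 => p - (k - b)
  | _, b :: l, i + 1 => stageCount k I (k - b) l i

/-- The number of busy servers a departure from which leads to `departState n x i`. -/
def departCount (n : ℕ) (x : QState k t) (i : ℕ) : ℕ :=
  if Saturated n x then (if i = 0 then n else 0)
  else stageCount k (idleCount n x) n (counts x) i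

/-- The generator of the reduced chain. -/
noncomputable def generator (n k t : ℕ) (lam mu : ℝ) : Matrix (QState k t) (QState k t) ℝ :=
  fun x y =>
    lam * ((if arriveState n x = y then 1 else 0) - if x = y then 1 else 0) +
      mu * ∑ i ∈ Finset.range (t + 1), (departCount n x i : ℝ) *
        ((if departState n x i = y then 1 else 0) - if x = y then 1 else 0)

/-! ## The quasi-birth-death structure -/

/-- Each transition from `x` to `z` contributes a multiple of `δ_z - δ_x` to the row of `x`, so the
rows sum to zero. The multiplicities are natural numbers, hence nonnegative even at unreachable
states, where the truncated subtractions have no meaning. -/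
theorem isGenerator_generator {lam mu : ℝ} (hlam : 0 < lam) (hmu : 0 < mu) :
    IsGenerator (generator n k t lam mu) := by
  refine ⟨fun x y hxy => ?_, fun x => ?_⟩
  · simp only [generator, hxy, if_false, sub_zero]
    positivity
  · have h (z : QState k t) :
        HasSum (fun y => (if z = y then (1 : ℝ) else 0) - if x = y then 1 else 0) 0 := by
      have h1 (z : QState k t) : HasSum (fun y => if z = y then (1 : ℝ) else 0) 1 := by
        simpa [eq_comm] using hasSum_ite_eq z (1 : ℝ)
      simpa using (h1 z).sub (h1 x)
    have key := ((h (arriveState n x)).mul_left lam).add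
      ((hasSum_sum (s := Finset.range (t + 1)) fun i _ =>
        (h (departState n x i)).mul_left (departCount n x i : ℝ)).mul_left mu)
    simp only [mul_zero, Finset.sum_const_zero, add_zero] at key
    exact key

theorem sum_counts_le (x : QState k t) : (counts x).sum ≤ t * k := by
  have h : (counts x).length ≤ t := (List.length_filter_le _ _).trans (by simp)
  refine (List.sum_le_card_nsmul _ k fun a ha => ?_).trans ?_
  · simp only [counts, List.mem_filter, List.mem_ofFn'] at ha
    obtain ⟨⟨i, rfl⟩, -⟩ := ha
    exact Nat.lt_succ_iff.1 (x.1 i).2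
  · simpa using Nat.mul_le_mul_right k h

/-- Such a state is saturated whatever its `w`, which makes the rates invariant under shifts of `m`.
The last argument `0` of `pack` is a dummy, since only the first component is used. -/
theorem generator_of_lt {lam mu : ℝ} {x : QState k t} (hx : n + t * k < x.2) (y : QState k t) :
    generator n k t lam mu x y =
      lam * ((if (x.1, x.2 + k) = y then 1 else 0) - if x = y then 1 else 0) +
      mu * (n * ((if ((pack t (relaxedCounts k (counts x)) 0 : QState k t).1, x.2 - 1) = y
        then 1 else 0) - if x = y then 1 else 0)) := by
  have hs : Saturated n x := by
    have := sum_counts_le x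
    unfold Saturated; omega
  simp only [generator, arriveState, departState, departCount, hs, if_true]
  -- `departCount` vanishes except at the index `0`, whose term is split off here.
  rw [Finset.sum_range_succ']
  simp [pack]

/-- Level number `i` begins at `n + 1 + t * k + i * k` jobs. `counts` ignores the number of jobs,
hence the dummy `0` in `counts (l.1, 0)`; only three job numbers still depend on `i`. -/
theorem generator_levelState {lam mu : ℝ} (hkn : k ≤ n) (i : ℕ)
    (l : (Fin t → Fin (k + 1)) × Fin k) (y : QState k t) :
    generator n k t lam mu (levelState n k t (t + 1 + i) l) y =
      lam * ((if (l.1, n + 1 + t * k + (i + 1) * k + l.2) = y then 1 else 0) -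
        if (l.1, n + 1 + t * k + i * k + l.2) = y then 1 else 0) +
      mu * (n * ((if ((pack t (relaxedCounts k (counts (l.1, 0))) 0 : QState k t).1,
        n + t * k + i * k + l.2) = y
        then 1 else 0) - if (l.1, n + 1 + t * k + i * k + l.2) = y then 1 else 0)) := by
  have h : levelState n k t (t + 1 + i) l = (l.1, n + 1 + t * k + i * k + l.2) := by
    simp only [levelState, Prod.mk.injEq, true_and]
    zify [hkn]; ring
  rw [h, generator_of_lt (by simp only; omega)]
  have h1 : n + 1 + t * k + i * k + (l.2 : ℕ) + k = n + 1 + t * k + (i + 1) * k + l.2 := by ring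
  have h2 : n + 1 + t * k + i * k + (l.2 : ℕ) - 1 = n + t * k + i * k + l.2 := by omega
  simp only [h1, h2]
  rfl

theorem levelState_eq (hkn : k ≤ n) (i : ℕ) (l : (Fin t → Fin (k + 1)) × Fin k) :
    levelState n k t (t + 1 + i) l = (l.1, n + 1 + t * k + i * k + l.2) := by
  simp only [levelState, Prod.mk.injEq, true_and]
  zify [hkn]; ring

/-- The entries are built from indicators of equations between job numbers, and after cancellation
these see the levels only through `i - j`. So each diagonal of blocks is constant and can be read
off at the levels `0` and `1`. -/
theorem generator_levelState_levelState {lam mu : ℝ} (hkn : k ≤ n) (i j : ℕ)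
    (l l' : (Fin t → Fin (k + 1)) × Fin k) :
    generator n k t lam mu (levelState n k t (t + 1 + i) l) (levelState n k t (t + 1 + j) l') =
      if i = j + 1 then
        generator n k t lam mu (levelState n k t (t + 1 + 1) l) (levelState n k t (t + 1 + 0) l')
      else if i = j then
        generator n k t lam mu (levelState n k t (t + 1 + 0) l) (levelState n k t (t + 1 + 0) l')
      else if j = i + 1 then
        generator n k t lam mu (levelState n k t (t + 1 + 0) l) (levelState n k t (t + 1 + 1) l')
      else 0 := by
  have hl := l.2.2
  have hl' := l'.2.2
  split_ifs with h1 h2 h3 <;> simp only [generator_levelState hkn] <;>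
    simp only [levelState_eq hkn, Prod.mk.injEq]
  · subst h1
    have e1 : (n + 1 + t * k + (j + 1 + 1) * k + (l.2 : ℕ) = n + 1 + t * k + j * k + l'.2) ↔
      (n + 1 + t * k + (1 + 1) * k + (l.2 : ℕ) = n + 1 + t * k + 0 * k + l'.2) := by
      ring_nf; omega
    have e2 : (n + 1 + t * k + (j + 1) * k + (l.2 : ℕ) = n + 1 + t * k + j * k + l'.2) ↔
      (n + 1 + t * k + 1 * k + (l.2 : ℕ) = n + 1 + t * k + 0 * k + l'.2) := by
      ring_nf; omega
    have e3 : (n + t * k + (j + 1) * k + (l.2 : ℕ) = n + 1 + t * k + j * k + l'.2) ↔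
      (n + t * k + 1 * k + (l.2 : ℕ) = n + 1 + t * k + 0 * k + l'.2) := by
      ring_nf; omega
    simp only [e1, e2, e3]
  · subst h2
    have e1 : (n + 1 + t * k + (i + 1) * k + (l.2 : ℕ) = n + 1 + t * k + i * k + l'.2) ↔
      (n + 1 + t * k + (0 + 1) * k + (l.2 : ℕ) = n + 1 + t * k + 0 * k + l'.2) := by
      ring_nf; omega
    have e2 : (n + 1 + t * k + i * k + (l.2 : ℕ) = n + 1 + t * k + i * k + l'.2) ↔
      (n + 1 + t * k + 0 * k + (l.2 : ℕ) = n + 1 + t * k + 0 * k + l'.2) := by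
      ring_nf; omega
    have e3 : (n + t * k + i * k + (l.2 : ℕ) = n + 1 + t * k + i * k + l'.2) ↔
      (n + t * k + 0 * k + (l.2 : ℕ) = n + 1 + t * k + 0 * k + l'.2) := by
      ring_nf; omega
    simp only [e1, e2, e3]
  · subst h3
    have e1 : (n + 1 + t * k + (i + 1) * k + (l.2 : ℕ) = n + 1 + t * k + (i + 1) * k + l'.2) ↔
      (n + 1 + t * k + (0 + 1) * k + (l.2 : ℕ) = n + 1 + t * k + 1 * k + l'.2) := by
      ring_nf; omega
    have e2 : (n + 1 + t * k + i * k + (l.2 : ℕ) = n + 1 + t * k + (i + 1) * k + l'.2) ↔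
      (n + 1 + t * k + 0 * k + (l.2 : ℕ) = n + 1 + t * k + 1 * k + l'.2) := by
      ring_nf; omega
    have e3 : (n + t * k + i * k + (l.2 : ℕ) = n + 1 + t * k + (i + 1) * k + l'.2) ↔
      (n + t * k + 0 * k + (l.2 : ℕ) = n + 1 + t * k + 1 * k + l'.2) := by
      ring_nf; omega
    simp only [e1, e2, e3]
  -- Job numbers in levels at distance at least two differ by more than `k`, while a jump changes
  -- the number by `k` or by `1`.
  · have key : j + 2 ≤ i ∨ i + 2 ≤ j := by omega
    have : j * k + 2 * k ≤ i * k ∨ i * k + 2 * k ≤ j * k := by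
      rcases key with h | h
      · left; rw [← add_mul]; exact Nat.mul_le_mul_right k h
      · right; rw [← add_mul]; exact Nat.mul_le_mul_right k h
    have e1 : ¬ (n + 1 + t * k + (i + 1) * k + (l.2 : ℕ) = n + 1 + t * k + j * k + l'.2) := by
      rw [add_mul]; omega
    have e2 : ¬ (n + 1 + t * k + i * k + (l.2 : ℕ) = n + 1 + t * k + j * k + l'.2) := by omega
    have e3 : ¬ (n + t * k + i * k + (l.2 : ℕ) = n + 1 + t * k + j * k + l'.2) := by omega
    simp [e1, e2, e3]

theorem arriveState_snd (x : QState k t) : (arriveState n x).2 = x.2 + k := by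
  unfold arriveState; split_ifs <;> rfl

theorem departState_snd (x : QState k t) (i : ℕ) : (departState n x i).2 = x.2 - 1 := by
  unfold departState; split_ifs <;> rfl

/-- For the rows of the boundary: jobs are gained only `k` at a time, so an arrival there cannot
pass the first level. -/
theorem generator_eq_zero {lam mu : ℝ} {x y : QState k t} (h : x.2 < y.2) (h' : y.2 ≠ x.2 + k) :
    generator n k t lam mu x y = 0 := by
  have e1 : arriveState n x ≠ y := fun e => h' (by rw [← e, arriveState_snd])
  have e2 : x ≠ y := fun e => h.ne (by rw [e])
  have e3 (i) : departState n x i ≠ y := fun e => by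
    have := departState_snd (n := n) x i
    rw [e] at this; omega
  simp [generator, e1, e2, e3]

theorem isQBD_generator (hk : 1 ≤ k) (hkn : k ≤ n) {lam mu : ℝ} (hlam : 0 < lam) (hmu : 0 < mu) :
    IsQBD (generator n k t lam mu) (boundary n k t) (fun i => level n k t (t + 1 + i))
      (fun i => levelState n k t (t + 1 + i)) where
  generator := isGenerator_generator hlam hmu
  boundary_finite := by
    refine (Set.finite_univ.prod (Set.finite_Iic (n + t * k))).subset fun x hx => ?_
    simpa [boundary] using hx
  phase_finite := inferInstance
  phase_injective i l l' h := by
    simp only [levelState_eq hkn, Prod.mk.injEq] at h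
    exact Prod.ext h.1 (Fin.ext (by omega))
  phase_range i := by
    ext ⟨w, m⟩
    simp only [level, Set.mem_range, Set.mem_ofPred_eq]
    constructor
    · rintro ⟨l, hl⟩
      simp only [levelState, Prod.mk.injEq] at hl
      have := l.2.2
      omega
    · rintro ⟨h1, h2⟩
      refine ⟨(w, ⟨m - (n - k + 1 + (t + 1 + i) * k), by omega⟩), ?_⟩
      simp only [levelState, Prod.mk.injEq, true_and]
      omega
  boundary_disjoint i := by
    refine Set.disjoint_left.2 fun x h1 h2 => ?_
    simp only [boundary, level, Set.mem_ofPred_eq, add_mul] at h1 h2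
    omega
  level_disjoint i j hij := by
    refine Set.disjoint_left.2 fun x h1 h2 => ?_
    simp only [level, Set.mem_ofPred_eq] at h1 h2
    rcases Nat.lt_or_gt_of_ne hij with h | h
    · have := Nat.mul_le_mul_right k (show t + 1 + i + 1 ≤ t + 1 + j by omega)
      rw [add_mul _ 1] at this
      omega
    · have := Nat.mul_le_mul_right k (show t + 1 + j + 1 ≤ t + 1 + i by omega)
      rw [add_mul _ 1] at this
      omega
  cover := by
    refine Set.eq_univ_of_forall fun x => ?_
    by_cases hx : x.2 ≤ n + t * k
    · exact Or.inl hx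
    · refine Or.inr (Set.mem_iUnion.2 ⟨(x.2 - (n + t * k + 1)) / k, ?_⟩)
      have h1 := Nat.div_add_mod (x.2 - (n + t * k + 1)) k
      have h2 := Nat.mod_lt (x.2 - (n + t * k + 1)) hk
      simp only [level, Set.mem_ofPred_eq, add_mul]
      rw [mul_comm] at h1
      omega
  blocks := by
    refine ⟨fun l b => generator n k t lam mu (levelState n k t (t + 1 + 0) l) b,
      fun b b' => generator n k t lam mu b b',
      fun b l => generator n k t lam mu b (levelState n k t (t + 1 + 0) l),
      fun l l' => generator n k t lam mu (levelState n k t (t + 1 + 1) l)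
        (levelState n k t (t + 1 + 0) l'),
      fun l l' => generator n k t lam mu (levelState n k t (t + 1 + 0) l)
        (levelState n k t (t + 1 + 0) l'),
      fun l l' => generator n k t lam mu (levelState n k t (t + 1 + 0) l)
        (levelState n k t (t + 1 + 1) l'), ?_⟩
    ext p q
    rcases p with b | ⟨i, l⟩ <;> rcases q with b' | ⟨j, l'⟩
    · rfl
    · simp only [Matrix.submatrix_apply, Sum.elim_inl, Sum.elim_inr, qbdMatrix]
      split_ifs with h
      · rw [h]
      · have hb : b.1.2 ≤ n + t * k := b.2
        have := Nat.mul_le_mul_right k (Nat.one_le_iff_ne_zero.2 h)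
        refine generator_eq_zero ?_ ?_ <;> rw [levelState_eq hkn] <;> simp only <;> omega
    · simp only [Matrix.submatrix_apply, Sum.elim_inl, Sum.elim_inr, qbdMatrix]
      split_ifs with h
      · rw [h]
      · have hb : b'.1.2 ≤ n + t * k := b'.2
        have := Nat.mul_le_mul_right k (Nat.one_le_iff_ne_zero.2 h)
        -- From the second level on, even the state after a departure has more than `n + t * k`
        -- jobs.
        have e (w : Fin t → Fin (k + 1)) (m : ℕ) (hm : n + t * k < m) : (w, m) ≠ b'.1 :=
          fun e => by rw [← e] at hb; simp only at hb; omega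
        rw [generator_levelState hkn, if_neg (e _ _ (by omega)), if_neg (e _ _ (by omega)),
          if_neg (e _ _ (by omega))]
        simp
    · exact generator_levelState_levelState hkn i j l l'

/-! ## Reachable configurations -/

/-- The invariant of the configurations that the policy can reach. -/
structure Config.Good (t : ℕ) (c : Config n k) : Prop where
  waiting_ne_zero : ∀ b ∈ c.buffer, b.waiting ≠ 0
  idle_subset : ∀ b ∈ c.buffer, c.idle ⊆ b.served
  nested : c.buffer.Pairwise fun b b' => b'.served ⊆ b.served
  busy_eq_univ : t < c.buffer.length → c.busy = Finset.univ
  -- The head is exempt: above `t` waiting batches its jobs may go to servers that have already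
  -- served it.
  card_served_of_mem_tail : ∀ b ∈ c.buffer.tail, b.served.card + b.waiting = k
  card_served : c.buffer.length ≤ t → ∀ b ∈ c.buffer, b.served.card + b.waiting = k
  -- The maximum with `1` is for `t = 0`, where the first waiting batch may still be partly started.
  waiting_of_mem_drop : ∀ b ∈ c.buffer.drop (max t 1), b.waiting = k

theorem Config.good_empty : (⟨∅, []⟩ : Config n k).Good t where
  waiting_ne_zero := by simp
  idle_subset := by simp
  nested := by simp
  busy_eq_univ := by simp
  card_served_of_mem_tail := by simp
  card_served := by simp
  waiting_of_mem_drop := by simp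

theorem serveFirst_false (s : Fin n) (q : List (Batch n k)) :
    (serveFirst false s q = none ∧ ∀ b ∈ q, s ∈ b.served) ∨
      ∃ q₁ b q₂, q = q₁ ++ b :: q₂ ∧ s ∉ b.served ∧ (∀ b' ∈ q₁, s ∈ b'.served) ∧
        serveFirst false s q = some (q₁ ++ requeue (b.assign {s}) q₂) := by
  induction q with
  | nil => left; simp [serveFirst]
  | cons b q ih =>
    by_cases hs : s ∈ b.served
    · rcases ih with ⟨h1, h2⟩ | ⟨q₁, b', q₂, rfl, h1, h2, h3⟩
      · left; simp [serveFirst, hs, h1]; exact h2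
      · right
        refine ⟨b :: q₁, b', q₂, rfl, h1, by simpa [hs] using h2, ?_⟩
        simp [serveFirst, hs, h3]
    · right
      exact ⟨[], b, q, rfl, hs, by simp, by simp [serveFirst, hs]⟩

theorem mem_requeue {b b' : Batch n k} {q : List (Batch n k)} (h : b' ∈ requeue b q) :
    (b' = b ∧ b.waiting ≠ 0) ∨ b' ∈ q := by
  unfold requeue at h
  split_ifs at h <;> simp_all

/-- Above `t` waiting batches only the head changes; if it leaves, all the remaining batches satisfy
the size condition, which is what `card_served` needs if `t` are left. Otherwise `s` joins the
served set of the first batch lacking it, and lies in all earlier ones, so nesting survives; it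
becomes idle only if it lies in all of them. -/
theorem Config.Good.depart {c : Config n k} (hc : c.Good t) {s : Fin n} (hs : s ∈ c.busy) :
    (c.depart t s).Good t := by
  obtain ⟨busy, buffer⟩ := c
  by_cases hL : t < buffer.length
  · obtain _ | ⟨b, rest⟩ := buffer
    · simp at hL
    have hbusy : busy = Finset.univ := hc.busy_eq_univ hL
    have hdep : Config.depart t s ⟨busy, b :: rest⟩ = ⟨busy, requeue (b.assign {s}) rest⟩ := by
      simp [Config.depart, serveFirst] at hL ⊢
      simp [hL]
    have hdrop : (b :: rest).drop (max t 1) = rest.drop (max t 1 - 1) := by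
      rw [← Nat.sub_add_cancel (le_max_right t 1), List.drop_succ_cons]; rfl
    have hw := hc.waiting_of_mem_drop
    have htail := hc.card_served_of_mem_tail
    have hnested := hc.nested
    have hpos := hc.waiting_ne_zero
    rw [List.pairwise_cons] at hnested
    simp only [hdrop, List.tail_cons] at hw htail
    rw [hdep]
    subst hbusy
    unfold requeue
    split_ifs with h0
    · exact
      { waiting_ne_zero := fun b' hb' => hpos b' (by simp [hb'])
        idle_subset := by simp [Config.idle]
        nested := hnested.2
        busy_eq_univ := fun _ => rfl
        card_served_of_mem_tail := fun b' hb' => htail b' (List.mem_of_mem_tail hb')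
        card_served := fun _ b' hb' => htail b' hb'
        waiting_of_mem_drop := fun b' hb' => hw b' (by
          refine List.mem_of_mem_drop (i := 1) ?_
          rwa [List.drop_drop, Nat.sub_add_cancel (le_max_right t 1)]) }
    · exact
      { waiting_ne_zero := by
          simp only [List.mem_cons, forall_eq_or_imp]
          exact ⟨h0, fun b' hb' => hpos b' (by simp [hb'])⟩
        idle_subset := by simp [Config.idle]
        nested := List.pairwise_cons.2
          ⟨fun b' hb' => (hnested.1 b' hb').trans Finset.subset_union_left, hnested.2⟩
        busy_eq_univ := fun _ => rfl
        card_served_of_mem_tail := htail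
        card_served := fun h => by simp at h hL; omega
        waiting_of_mem_drop := by
          rw [← Nat.sub_add_cancel (le_max_right t 1), List.drop_succ_cons]; exact hw }
  · have hdec : decide (t < buffer.length) = false := by simpa using hL
    have hpos := hc.waiting_ne_zero
    have hidle := hc.idle_subset
    have hnested := hc.nested
    have hcard := hc.card_served (not_lt.1 hL)
    rcases serveFirst_false s buffer with ⟨h1, h2⟩ | ⟨q₁, b, q₂, rfl, h1, h2, h3⟩
    · have hdep : Config.depart t s ⟨busy, buffer⟩ = ⟨busy.erase s, buffer⟩ := by
        simp [Config.depart, hdec, h1]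
      rw [hdep]
      refine ⟨hpos, fun b hb => ?_, hnested, fun h => absurd h hL, hc.card_served_of_mem_tail,
        hc.card_served, hc.waiting_of_mem_drop⟩
      simp only [Config.idle, Finset.compl_erase, Finset.insert_subset_iff]
      exact ⟨h2 b hb, hidle b hb⟩
    · have hdep : Config.depart t s ⟨busy, q₁ ++ b :: q₂⟩ =
          ⟨busy, q₁ ++ requeue (b.assign {s}) q₂⟩ := by
        simp only [Config.depart, hdec, h3]
      have hb0 := hpos b (by simp)
      have hbk := hcard b (by simp)
      have hcard' : ∀ b' ∈ q₁ ++ requeue (b.assign {s}) q₂, b'.served.card + b'.waiting = k := by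
        intro b' hb'
        rcases List.mem_append.1 hb' with h | h
        · exact hcard b' (by simp [h])
        · rcases mem_requeue h with ⟨rfl, -⟩ | h
          · simp only [Batch.assign, Finset.card_singleton]
            rw [Finset.card_union_of_disjoint (by simpa using h1), Finset.card_singleton]
            omega
          · exact hcard b' (by simp [h])
      have hlen : (q₁ ++ requeue (b.assign {s}) q₂).length ≤ t := by
        have : (requeue (b.assign {s}) q₂).length ≤ q₂.length + 1 := by
          unfold requeue; split_ifs <;> simp
        simp at hL ⊢; omega
      rw [hdep]
      refine ⟨fun b' hb' => ?_, fun b' hb' => ?_, ?_, fun h => absurd h (not_lt.2 hlen),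
        fun b' hb' => hcard' b' (List.mem_of_mem_tail hb'), fun _ => hcard', ?_⟩
      · rcases List.mem_append.1 hb' with h | h
        · exact hpos b' (by simp [h])
        · rcases mem_requeue h with ⟨rfl, h'⟩ | h
          · exact h'
          · exact hpos b' (by simp [h])
      · rcases List.mem_append.1 hb' with h | h
        · exact hidle b' (by simp [h])
        · rcases mem_requeue h with ⟨rfl, h⟩ | h
          · exact (hidle b (by simp)).trans Finset.subset_union_left
          · exact hidle b' (by simp [h])
      · rw [List.pairwise_append, List.pairwise_cons] at hnested
        obtain ⟨hq₁, ⟨hbq₂, hq₂⟩, hq⟩ := hnested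
        rw [List.pairwise_append]
        refine ⟨hq₁, ?_, fun a ha a' ha' => ?_⟩
        · unfold requeue
          split_ifs
          · exact hq₂
          · exact List.pairwise_cons.2
              ⟨fun b' hb' => (hbq₂ b' hb').trans Finset.subset_union_left, hq₂⟩
        · rcases mem_requeue ha' with ⟨rfl, -⟩ | h
          · exact Finset.union_subset (hq a ha b (by simp)) (by simpa using h2 a ha)
          · exact hq a ha a' (by simp [h])
      · rw [List.drop_eq_nil_of_le (hlen.trans (le_max_left t 1))]
        simp

/-- Nesting originates here: if jobs remain, the new batch has taken every idle server, so its
served set is the old idle set, which every earlier served set contains. The alternative `q = []`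
covers `t = 0`. -/
theorem Config.Good.enqueue_new {busy : Finset (Fin n)} {q : List (Batch n k)}
    (hc : (⟨busy, q⟩ : Config n k).Good t) (hq : q = [] ∨ q.length < t) {U : Finset (Fin n)}
    (hU : U ⊆ busyᶜ) (hcard : U.card = min k busyᶜ.card) :
    (⟨busy ∪ U, enqueue q (Batch.new.assign U)⟩ : Config n k).Good t := by
  have hlt : ¬ t < q.length := by rcases hq with rfl | h <;> simp; omega
  unfold enqueue
  split_ifs with h0
  · exact
    { waiting_ne_zero := hc.waiting_ne_zero
      idle_subset := fun b hb => (Finset.compl_subset_compl.2 Finset.subset_union_left).trans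
        (hc.idle_subset b hb)
      nested := hc.nested
      busy_eq_univ := fun h => absurd h hlt
      card_served_of_mem_tail := hc.card_served_of_mem_tail
      card_served := hc.card_served
      waiting_of_mem_drop := hc.waiting_of_mem_drop }
  · have hUeq : U = busyᶜ := by
      refine Finset.eq_of_subset_of_card_le hU ?_
      simp only [Batch.assign, Batch.new] at h0
      omega
    have huniv : busy ∪ U = Finset.univ := by simp [hUeq]
    have hUk : U.card ≤ k := hcard ▸ min_le_left _ _
    have hall : ∀ b ∈ q ++ [Batch.new.assign U], b.served.card + b.waiting = k := by
      intro b hb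
      rcases List.mem_append.1 hb with h | h
      · exact hc.card_served (not_lt.1 hlt) b h
      · rw [List.mem_singleton.1 h]
        simp [Batch.assign, Batch.new, hUk]
    refine ⟨fun b hb => ?_, ?_, ?_, fun _ => huniv, fun b hb => hall b (List.mem_of_mem_tail hb),
      fun _ => hall, ?_⟩
    · rcases List.mem_append.1 hb with h | h
      · exact hc.waiting_ne_zero b h
      · rw [List.mem_singleton.1 h]; exact h0
    · simp [Config.idle, huniv]
    · rw [List.pairwise_append]
      refine ⟨hc.nested, by simp, fun b hb b' hb' => ?_⟩
      rw [List.mem_singleton.1 hb']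
      simpa [Batch.assign, Batch.new, hUeq, Config.idle] using hc.idle_subset b hb
    · rw [List.drop_eq_nil_of_le]
      · simp
      · rcases hq with rfl | h <;> simp; omega

theorem Config.Good.arrive (hk : 1 ≤ k) {c : Config n k} (hc : c.Good t)
    (rule : AssignmentRule n k) : (c.arrive t rule).Good t := by
  obtain ⟨busy, buffer⟩ := c
  obtain _ | ⟨b, rest⟩ := buffer
  · exact hc.enqueue_new (Or.inl rfl) (rule.pick_subset _ _ _) (rule.card_pick _ _ _)
  simp only [Config.arrive]
  have hnew : ∀ q : List (Batch n k), enqueue q Batch.new = q ++ [Batch.new] := by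
    intro q
    have hk0 : k ≠ 0 := by omega
    simp [enqueue, Batch.new, hk0]
  split_ifs with h1 h2 h3
  · exact hc.enqueue_new (Or.inr h1) (rule.pick_subset _ _ _) (rule.card_pick _ _ _)
  -- With the first batch cleared, the intermediate configuration is again `Good` and has fewer than
  -- `t` waiting batches, so the new batch falls under `Config.Good.enqueue_new`.
  · have hrest : (⟨busy ∪ rule.pick ⟨busy, b :: rest⟩ (Config.idle ⟨busy, b :: rest⟩) b.waiting,
        rest⟩ : Config n k).Good t :=
      { waiting_ne_zero := fun b' hb' => hc.waiting_ne_zero b' (by simp [hb'])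
        idle_subset := fun b' hb' => (Finset.compl_subset_compl.2 Finset.subset_union_left).trans
          (hc.idle_subset b' (by simp [hb']))
        nested := (List.pairwise_cons.1 hc.nested).2
        busy_eq_univ := fun h => by simp at h h2; omega
        card_served_of_mem_tail := fun b' hb' =>
          hc.card_served_of_mem_tail b' (List.mem_of_mem_tail hb')
        card_served := fun _ b' hb' => hc.card_served_of_mem_tail b' hb'
        waiting_of_mem_drop := by
          rw [List.drop_eq_nil_of_le]
          · simp
          · simp at h2 ⊢; omega }
    have hidle : (busy ∪ rule.pick ⟨busy, b :: rest⟩ (Config.idle ⟨busy, b :: rest⟩) b.waiting)ᶜ =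
        Config.idle ⟨busy, b :: rest⟩ \
          rule.pick ⟨busy, b :: rest⟩ (Config.idle ⟨busy, b :: rest⟩) b.waiting := by
      rw [Finset.compl_union, Finset.sdiff_eq_inter_compl, Config.idle]
    refine hrest.enqueue_new (Or.inr (by simp at h2; omega)) ?_ ?_
    · rw [hidle]; exact rule.pick_subset _ _ _
    · rw [hidle]; exact rule.card_pick _ _ _
  · have hsub := rule.pick_subset ⟨busy, b :: rest⟩ (Config.idle ⟨busy, b :: rest⟩) b.waiting
    have hcard := rule.card_pick ⟨busy, b :: rest⟩ (Config.idle ⟨busy, b :: rest⟩) b.waiting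
    set U := rule.pick ⟨busy, b :: rest⟩ (Config.idle ⟨busy, b :: rest⟩) b.waiting
    -- The first batch is not cleared, so it has absorbed all idle servers.
    have hUeq : U = busyᶜ := by
      refine Finset.eq_of_subset_of_card_le hsub ?_
      simp only [Batch.assign] at h3
      simp only [Config.idle] at hcard
      omega
    have huniv : busy ∪ U = Finset.univ := by simp [hUeq]
    have hnested := List.pairwise_cons.1 hc.nested
    have hcards := hc.card_served h2.le
    rw [hnew]
    simp only [List.length_cons] at h2
    refine ⟨fun b' hb' => ?_, ?_, ?_, fun _ => huniv, fun b' hb' => ?_, fun h => ?_, ?_⟩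
    · simp only [List.cons_append, List.mem_cons, List.mem_append, List.not_mem_nil, or_false]
        at hb'
      rcases hb' with rfl | h | rfl
      · exact h3
      · exact hc.waiting_ne_zero b' (by simp [h])
      · simp only [Batch.new]; omega
    · simp [Config.idle, huniv]
    · rw [List.pairwise_append, List.pairwise_cons]
      exact ⟨⟨fun b' hb' => (hnested.1 b' hb').trans Finset.subset_union_left, hnested.2⟩, by simp,
        by simp [Batch.new]⟩
    · simp only [List.cons_append, List.tail_cons, List.mem_append, List.mem_singleton] at hb'
      rcases hb' with h | rfl
      · exact hcards b' (by simp [h])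
      · simp [Batch.new]
    · simp at h; omega
    · have : max t 1 = (b.assign U :: rest).length := by simp; omega
      rw [this, List.drop_left]
      simp [Batch.new]
  · have hlt : t < (b :: rest).length := by omega
    have huniv : busy = Finset.univ := hc.busy_eq_univ hlt
    rw [hnew]
    refine ⟨fun b' hb' => ?_, ?_, ?_, fun _ => huniv, fun b' hb' => ?_, fun h => ?_,
      fun b' hb' => ?_⟩
    · rcases List.mem_append.1 hb' with h | h
      · exact hc.waiting_ne_zero b' h
      · rw [List.mem_singleton.1 h]; simp only [Batch.new]; omega
    · simp [Config.idle, huniv]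
    · rw [List.pairwise_append]
      exact ⟨hc.nested, by simp, by simp [Batch.new]⟩
    · simp only [List.cons_append, List.tail_cons, List.mem_append, List.mem_singleton] at hb'
      rcases hb' with h | rfl
      · exact hc.card_served_of_mem_tail b' h
      · simp [Batch.new]
    · simp at h hlt; omega
    · rw [List.drop_append] at hb'
      rcases List.mem_append.1 hb' with h | h
      · exact hc.waiting_of_mem_drop b' h
      · rw [List.mem_singleton.1 (List.mem_of_mem_drop h)]; rfl

theorem Config.Good.next (hk : 1 ≤ k) {c : Config n k} (hc : c.Good t)
    (rule : AssignmentRule n k) {e : Event n} (he : e ∈ Finset.insertNone c.busy) :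
    (c.next t rule e).Good t := by
  cases e with
  | none => exact hc.arrive hk rule
  | some s => exact hc.depart (by simpa using he)

/-! ## The transitions of the reduced state of a reachable configuration -/

theorem map_waiting_enqueue (q : List (Batch n k)) (b : Batch n k) :
    (enqueue q b).map Batch.waiting = q.map Batch.waiting ++ nonzeroSingleton b.waiting := by
  unfold enqueue nonzeroSingleton
  split_ifs <;> simp

theorem map_waiting_requeue (b : Batch n k) (q : List (Batch n k)) :
    (requeue b q).map Batch.waiting = nonzeroSingleton b.waiting ++ q.map Batch.waiting := by
  unfold requeue nonzeroSingleton
  split_ifs <;> simp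

theorem sum_nonzeroSingleton (a : ℕ) : (nonzeroSingleton a).sum = a := by
  unfold nonzeroSingleton
  split_ifs <;> simp_all

theorem Config.state_snd (c : Config n k) : (c.state t).2 = c.jobs := rfl

theorem Config.Good.mem_counts {c : Config n k} (hc : c.Good t) :
    ∀ a ∈ c.counts, a ≠ 0 ∧ a ≤ k := by
  intro a ha
  obtain ⟨b, hb, rfl⟩ := List.mem_map.1 ha
  exact ⟨hc.waiting_ne_zero b hb, b.waiting_le⟩

theorem Config.Good.counts_state {c : Config n k} (hc : c.Good t) :
    MkMn.counts (c.state t) = c.counts.take t := by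
  rw [Config.state_eq_pack, counts_pack _ _ hc.mem_counts]

theorem Config.length_counts (c : Config n k) : c.counts.length = c.buffer.length :=
  List.length_map _

/-- If at most `t` batches wait, all waiting jobs are recorded and at most `n` others are in
service. If more wait, all `n` servers are busy and an unrecorded batch gives a positive excess. -/
theorem Config.Good.saturated_iff {c : Config n k} (hc : c.Good t) :
    Saturated n (c.state t) ↔ t < c.buffer.length := by
  unfold Saturated
  rw [hc.counts_state, Config.state_snd, Config.jobs, ← c.length_counts]
  have hsum := congrArg List.sum (List.take_append_drop t c.counts)
  rw [List.sum_append] at hsum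
  constructor
  · intro h
    by_contra hlt
    rw [List.take_of_length_le (not_lt.1 hlt)] at h
    have := card_finset_fin_le c.busy
    omega
  · intro h
    have hbusy : c.busy.card = n := by rw [hc.busy_eq_univ (by rwa [← c.length_counts])]; simp
    have hne : (c.counts.drop t).sum ≠ 0 := by
      rw [Ne, List.sum_eq_zero_iff]
      intro h0
      have hmem : c.counts[t] ∈ c.counts.drop t := by
        rw [List.drop_eq_getElem_cons h]; exact List.mem_cons_self
      exact (hc.mem_counts _ (List.mem_of_mem_drop hmem)).1 (h0 _ hmem)
    omega

theorem Config.Good.idleCount_state {c : Config n k} (hc : c.Good t) (h : c.buffer.length ≤ t) :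
    idleCount n (c.state t) = c.idle.card := by
  unfold idleCount
  rw [hc.counts_state, List.take_of_length_le (by rwa [c.length_counts]), Config.state_snd,
    Config.jobs, Config.idle, Finset.card_compl, Fintype.card_fin]
  omega

theorem Config.Good.counts_state_of_le {c : Config n k} (hc : c.Good t)
    (h : c.buffer.length ≤ t) : MkMn.counts (c.state t) = c.counts := by
  rw [hc.counts_state, List.take_of_length_le (by rwa [c.length_counts])]

/-! ### Arrivals -/

theorem card_union_pick (rule : AssignmentRule n k) (c : Config n k) {busy I : Finset (Fin n)}
    (h : Disjoint busy I) (j : ℕ) :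
    (busy ∪ rule.pick c I j).card = busy.card + min j I.card := by
  rw [Finset.card_union_of_disjoint (h.mono_right (rule.pick_subset c I j)), rule.card_pick]

theorem Config.disjoint_idle (c : Config n k) : Disjoint c.busy c.idle := disjoint_compl_right

theorem Config.jobs_arrive (rule : AssignmentRule n k) (c : Config n k) :
    (c.arrive t rule).jobs = c.jobs + k := by
  obtain ⟨busy, buffer⟩ := c
  have hU (j : ℕ) := card_union_pick rule ⟨busy, buffer⟩
    (Config.disjoint_idle ⟨busy, buffer⟩) j
  have hUc (j : ℕ) := rule.card_pick ⟨busy, buffer⟩ (Config.idle ⟨busy, buffer⟩) j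
  simp only at hU
  obtain _ | ⟨b, rest⟩ := buffer
  · simp only [Config.arrive, Config.jobs, Config.counts, map_waiting_enqueue, hU,
      List.sum_append, sum_nonzeroSingleton, Batch.assign, Batch.new, hUc]
    simp
  simp only [Config.arrive]
  split_ifs with h1 h2 h3
  · simp only [Config.jobs, Config.counts, map_waiting_enqueue, hU,
      List.sum_append, sum_nonzeroSingleton, Batch.assign, Batch.new, hUc]
    omega
  · have hdisj : Disjoint (busy ∪ rule.pick ⟨busy, b :: rest⟩ (Config.idle ⟨busy, b :: rest⟩)
        b.waiting) (Config.idle ⟨busy, b :: rest⟩ \ rule.pick ⟨busy, b :: rest⟩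
          (Config.idle ⟨busy, b :: rest⟩) b.waiting) :=
      Finset.disjoint_union_left.2 ⟨(Config.disjoint_idle ⟨busy, b :: rest⟩).mono_right
        Finset.sdiff_subset, Finset.disjoint_sdiff⟩
    simp only [Batch.assign, hUc] at h3
    simp only [Config.jobs, Config.counts, map_waiting_enqueue, card_union_pick _ _ hdisj, hU,
      List.sum_append, sum_nonzeroSingleton, Batch.assign, Batch.new, rule.card_pick,
      List.map_cons, List.sum_cons]
    omega
  · simp only [Batch.assign, hUc] at h3
    simp only [Config.jobs, Config.counts, map_waiting_enqueue, hU,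
      List.sum_append, sum_nonzeroSingleton, Batch.assign, Batch.new, hUc,
      List.map_cons, List.sum_cons]
    omega
  · simp only [Config.jobs, Config.counts, map_waiting_enqueue,
      List.sum_append, sum_nonzeroSingleton, Batch.new]
    omega

theorem nonzeroSingleton_sub_min (a b : ℕ) :
    nonzeroSingleton (a - min a b) = nonzeroSingleton (a - b) := by
  congr 1; omega

theorem Config.Good.state_arrive {c : Config n k} (hk : 1 ≤ k) (hc : c.Good t)
    (rule : AssignmentRule n k) : (c.arrive t rule).state t = arriveState n (c.state t) := by
  have hjobs := c.jobs_arrive (t := t) rule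
  have hsat := hc.saturated_iff
  have hidle := hc.idleCount_state
  have hcounts := hc.counts_state_of_le
  have hk0 : k ≠ 0 := by omega
  rw [Config.state_eq_pack, hjobs]
  unfold arriveState
  split_ifs with hs
  · rw [hsat] at hs
    obtain ⟨busy, buffer⟩ := c
    obtain _ | ⟨b, rest⟩ := buffer
    · simp at hs
    simp only at hs
    have h1 : ¬ (b :: rest).length < t := by omega
    have h2 : ¬ (b :: rest).length = t := by omega
    have : Config.counts (Config.arrive t rule ⟨busy, b :: rest⟩) =
        Config.counts ⟨busy, b :: rest⟩ ++ [k] := by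
      simp only [Config.arrive, h1, h2, if_false]
      simp [Config.counts, map_waiting_enqueue, Batch.new, nonzeroSingleton, hk0]
    -- The appended batch lies beyond the first `t` and is not recorded.
    rw [this, pack_append _ (by rw [Config.length_counts]; exact hs.le), Config.state_eq_pack]
    rfl
  · rw [hsat, not_lt] at hs
    rw [hidle hs, hcounts hs]
    refine congrArg (fun l => pack t l (c.jobs + k)) ?_
    have hUc (j : ℕ) := rule.card_pick c c.idle j
    have hUs (j : ℕ) := rule.pick_subset c c.idle j
    obtain ⟨busy, buffer⟩ := c
    obtain _ | ⟨b, rest⟩ := buffer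
    · simp [Config.arrive, Config.counts, map_waiting_enqueue, Batch.new, Batch.assign,
        arriveCounts, hUc, nonzeroSingleton_sub_min]
    have hlen : (Config.counts ⟨busy, rest⟩).length = rest.length := Config.length_counts _
    have hcons : Config.counts ⟨busy, b :: rest⟩ = b.waiting :: Config.counts ⟨busy, rest⟩ := rfl
    simp only [Config.arrive, hcons, arriveCounts, hlen]
    simp only [List.length_cons] at hs ⊢
    by_cases h1 : rest.length + 1 < t
    · simp [h1, Config.counts, map_waiting_enqueue, Batch.new, Batch.assign, hUc,
        nonzeroSingleton_sub_min]
    · have h2 : rest.length + 1 = t := by omega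
      simp only [h2, lt_irrefl, if_true, if_false]
      by_cases h3 : b.waiting ≤ (Config.idle ⟨busy, b :: rest⟩).card
      · have h4 : b.waiting - (Config.idle ⟨busy, b :: rest⟩ |> (rule.pick ⟨busy, b :: rest⟩ ·
            b.waiting)).card = 0 := by
          simp only [hUc]; omega
        have h5 := Finset.card_sdiff_of_subset (hUs b.waiting)
        rw [hUc, min_eq_left h3] at h5
        simp only [Batch.assign, h4, h3, if_true]
        simp [Config.counts, map_waiting_enqueue, Batch.new, rule.card_pick, h5,
          nonzeroSingleton_sub_min]
      · have h4 : ¬ (b.waiting - (Config.idle ⟨busy, b :: rest⟩ |> (rule.pick ⟨busy, b :: rest⟩ ·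
            b.waiting)).card = 0) := by
          simp only [hUc]; omega
        simp only [Batch.assign, h4, h3, if_false]
        simp [Config.counts, map_waiting_enqueue, Batch.new, hUc, nonzeroSingleton, hk0]
        omega

/-! ### Departures -/

/-- The number of the waiting batches that precede the earliest one that `s` has not served. -/
def depth (s : Fin n) (q : List (Batch n k)) : ℕ := q.findIdx fun b => s ∉ b.served

/-- If `s` has served every waiting batch, its depth is the length of the buffer; `decAt` past the
end changes nothing, in agreement with the default of `getD`. -/
theorem map_waiting_serveFirst (s : Fin n) (q : List (Batch n k)) :
    ((serveFirst false s q).getD q).map Batch.waiting =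
      decAt (q.map Batch.waiting) (depth s q) := by
  induction q with
  | nil => simp [serveFirst, decAt]
  | cons b q ih =>
    by_cases hs : s ∈ b.served
    · have hd : depth s (b :: q) = depth s q + 1 := by simp [depth, List.findIdx_cons, hs]
      rw [hd, List.map_cons, decAt, ← ih]
      cases h : serveFirst false s q <;> simp [serveFirst, hs, h]
    · have hd : depth s (b :: q) = 0 := by simp [depth, List.findIdx_cons, hs]
      rw [hd, List.map_cons, decAt]
      simp [serveFirst, hs, map_waiting_requeue, Batch.assign]

theorem Config.Good.jobs_depart {c : Config n k} (hc : c.Good t) {s : Fin n} (hs : s ∈ c.busy) :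
    (c.depart t s).jobs = c.jobs - 1 := by
  obtain ⟨busy, buffer⟩ := c
  have hpos := hc.waiting_ne_zero
  by_cases hL : t < buffer.length
  · obtain _ | ⟨b, rest⟩ := buffer
    · simp at hL
    have hdep : Config.depart t s ⟨busy, b :: rest⟩ = ⟨busy, requeue (b.assign {s}) rest⟩ := by
      simp [Config.depart, serveFirst] at hL ⊢
      simp [hL]
    rw [hdep]
    have := hpos b (by simp)
    simp only [Config.jobs, Config.counts, map_waiting_requeue, List.sum_append,
      sum_nonzeroSingleton, Batch.assign, Finset.card_singleton, List.map_cons, List.sum_cons]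
    omega
  · have hdec : decide (t < buffer.length) = false := by simpa using hL
    rcases serveFirst_false s buffer with ⟨h1, h2⟩ | ⟨q₁, b, q₂, rfl, h1, h2, h3⟩
    · have hdep : Config.depart t s ⟨busy, buffer⟩ = ⟨busy.erase s, buffer⟩ := by
        simp [Config.depart, hdec, h1]
      rw [hdep]
      have := Finset.card_pos.2 ⟨s, hs⟩
      simp only [Config.jobs, Config.counts, Finset.card_erase_of_mem hs] at this ⊢
      omega
    · have hdep : Config.depart t s ⟨busy, q₁ ++ b :: q₂⟩ =
          ⟨busy, q₁ ++ requeue (b.assign {s}) q₂⟩ := by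
        simp only [Config.depart, hdec, h3]
      rw [hdep]
      have := hpos b (by simp)
      simp only [Config.jobs, Config.counts, List.map_append, map_waiting_requeue, List.sum_append,
        sum_nonzeroSingleton, Batch.assign, Finset.card_singleton, List.map_cons, List.sum_cons]
      omega

/-- The index of the transition that a departure from the server `s` causes. -/
def Config.stage (t : ℕ) (c : Config n k) (s : Fin n) : ℕ :=
  if t < c.buffer.length then 0 else depth s c.buffer

theorem Config.stage_le (c : Config n k) (s : Fin n) : c.stage t s ≤ t := by
  unfold Config.stage
  split_ifs with h
  · exact Nat.zero_le t
  · exact List.findIdx_le_length.trans (not_lt.1 h)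

theorem Config.Good.state_depart {c : Config n k} (hc : c.Good t) {s : Fin n} (hs : s ∈ c.busy) :
    (c.depart t s).state t = departState n (c.state t) (c.stage t s) := by
  rw [Config.state_eq_pack, hc.jobs_depart hs]
  unfold departState Config.stage
  simp only [hc.saturated_iff]
  split_ifs with hL
  · rw [hc.counts_state, Config.state_snd]
    have hdrop := hc.waiting_of_mem_drop
    obtain ⟨busy, buffer⟩ := c
    obtain _ | ⟨b, rest⟩ := buffer
    · simp at hL
    have hdep : Config.depart t s ⟨busy, b :: rest⟩ = ⟨busy, requeue (b.assign {s}) rest⟩ := by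
      simp [Config.depart, serveFirst] at hL ⊢
      simp [hL]
    rw [hdep]
    obtain _ | t := t
    · exact Prod.ext (funext fun i => i.elim0) rfl
    · simp only [List.length_cons] at hL
      have ht : t < rest.length := by omega
      -- With `t` now standing for one less, `rest[t]` is the first unrecorded batch. It is
      -- untouched and supplies the entry `k` that comes into view if the head clears.
      have hrest : rest = rest.take t ++ rest[t] :: rest.drop (t + 1) := by
        rw [← List.drop_eq_getElem_cons ht, List.take_append_drop]
      have hk : rest[t].waiting = k := by
        refine hdrop _ ?_
        have : max (t + 1) 1 = t + 1 := by omega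
        simp only [this, List.drop_succ_cons]
        rw [List.drop_eq_getElem_cons ht]
        exact List.mem_cons_self
      have h1 : Config.counts ⟨busy, requeue (b.assign {s}) rest⟩ =
          (nonzeroSingleton (b.waiting - 1) ++ (rest.take t).map Batch.waiting ++ [k]) ++
            (rest.drop (t + 1)).map Batch.waiting := by
        simp only [Config.counts, map_waiting_requeue, Batch.assign, Finset.card_singleton]
        have := congrArg (List.map Batch.waiting) hrest
        rw [List.map_append, List.map_cons, hk] at this
        rw [this]
        simp only [List.append_assoc, List.cons_append, List.nil_append]
      rw [h1, pack_append]
      · simp [Config.counts, relaxedCounts]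
      · simp; omega
  · have hle := not_lt.1 hL
    rw [hc.counts_state_of_le hle, Config.state_snd]
    have hdec : decide (t < c.buffer.length) = false := by simpa using hL
    have h := map_waiting_serveFirst s c.buffer
    congr 1
    rw [Config.counts, Config.counts, ← h]
    unfold Config.depart
    rw [hdec]
    cases serveFirst false s c.buffer <;> rfl

/-- The chain of served sets from `T` down to `I` cuts `T \ I` into successive differences, and the
depth tells in which of them a server lies. `T` stands for the served set of the preceding batch,
which lets the induction run along the list. -/
theorem card_filter_depth (I T : Finset (Fin n)) (q : List (Batch n k)) (hT : I ⊆ T)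
    (hI : ∀ b ∈ q, I ⊆ b.served) (hqT : ∀ b ∈ q, b.served ⊆ T)
    (hq : q.Pairwise fun b b' => b'.served ⊆ b.served)
    (hcard : ∀ b ∈ q, b.served.card + b.waiting = k) (i : ℕ) :
    ((T \ I).filter fun s => depth s q = i).card =
      stageCount k I.card T.card (q.map Batch.waiting) i := by
  induction q generalizing T i with
  | nil =>
    have h0 (s : Fin n) : depth s ([] : List (Batch n k)) = 0 := rfl
    by_cases h : i = 0
    · simp [h0, stageCount, h, Finset.card_sdiff_of_subset hT]
    · simp [h0, stageCount, h, Ne.symm h]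
  | cons b q ih =>
    have hb : b.served.card = k - b.waiting := by have := hcard b (by simp); omega
    cases i with
    | zero =>
      have : ((T \ I).filter fun s => depth s (b :: q) = 0) = T \ b.served := by
        ext s
        have h1 := @hI b (by simp) s
        by_cases hs : s ∈ b.served <;> simp [depth, List.findIdx_cons, hs]
        intro _ h; exact hs (h1 h)
      rw [this, Finset.card_sdiff_of_subset (hqT b (by simp)), List.map_cons, stageCount, hb]
    | succ i =>
      have : ((T \ I).filter fun s => depth s (b :: q) = i + 1) =
          (b.served \ I).filter fun s => depth s q = i := by
        ext s
        have h1 := @hqT b (by simp) s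
        by_cases hs : s ∈ b.served
        · simp [depth, List.findIdx_cons, hs, h1 hs]
        · simp [depth, List.findIdx_cons, hs]
      rw [List.pairwise_cons] at hq
      rw [this, ih b.served (hI b (by simp)) (fun b' hb' => hI b' (by simp [hb']))
        (fun b' hb' => hq.1 b' hb') hq.2 (fun b' hb' => hcard b' (by simp [hb'])) i,
        List.map_cons, stageCount, hb]

theorem Config.Good.card_stage_eq {c : Config n k} (hc : c.Good t) (i : ℕ) :
    (c.busy.filter fun s => c.stage t s = i).card = departCount n (c.state t) i := by
  unfold departCount Config.stage
  simp only [hc.saturated_iff]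
  split_ifs with hL hi
  · subst hi
    simp [hc.busy_eq_univ hL]
  · rw [Finset.filter_false_of_mem (fun _ _ h => hi h.symm), Finset.card_empty]
  · have hle := not_lt.1 hL
    have h := card_filter_depth c.idle Finset.univ c.buffer (Finset.subset_univ _) hc.idle_subset
      (fun _ _ => Finset.subset_univ _) hc.nested (hc.card_served hle) i
    rw [hc.idleCount_state hle, hc.counts_state_of_le hle]
    simpa [Config.idle, Config.counts, ← Finset.compl_eq_univ_sdiff] using h

/-! ### Lumpability -/

/-- The rate of the exponential clock of the event. -/
def eventRate (lam mu : ℝ) : Event n → ℝ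
  | none => lam
  | some _ => mu

theorem eventRate_pos {lam mu : ℝ} (hlam : 0 < lam) (hmu : 0 < mu) (e : Event n) :
    0 < eventRate lam mu e := by
  cases e <;> assumption

/-- Busy servers of equal stage cause the same reduced transition, and their number is a function of
the reduced state. Hence the right-hand side forgets both the rule and the rest of the
configuration. -/
theorem Config.Good.generator_state {c : Config n k} (hk : 1 ≤ k) (hc : c.Good t)
    (rule : AssignmentRule n k) (lam mu : ℝ) (y : QState k t) :
    generator n k t lam mu (c.state t) y = ∑ e ∈ Finset.insertNone c.busy, eventRate lam mu e *
      ((if (c.next t rule e).state t = y then 1 else 0) - if c.state t = y then 1 else 0) := by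
  rw [Finset.sum_insertNone]
  simp only [eventRate, Config.next, hc.state_arrive hk, generator, ← Finset.mul_sum]
  congr 2
  rw [← Finset.sum_fiberwise_of_maps_to (t := Finset.range (t + 1)) (g := c.stage t)
    (fun s _ => Finset.mem_range.2 (Nat.lt_succ_of_le (c.stage_le s)))]
  refine Finset.sum_congr rfl fun i _ => ?_
  rw [← hc.card_stage_eq, ← nsmul_eq_mul, ← Finset.sum_const]
  refine Finset.sum_congr rfl fun s hs => ?_
  rw [Finset.mem_filter] at hs
  simp only [hc.state_depart hs.1, hs.2]

/-- Every event changes the number of jobs, so none is hidden from the reduced process: its jumps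
are exactly the events, and its exit rate is the total rate of the running clocks. -/
theorem Config.Good.state_next_ne {c : Config n k} (hk : 1 ≤ k) (hc : c.Good t)
    (rule : AssignmentRule n k) {e : Event n} (he : e ∈ Finset.insertNone c.busy) :
    (c.next t rule e).state t ≠ c.state t := by
  intro h
  have h2 := congrArg Prod.snd h
  simp only [Config.state_snd] at h2
  cases e with
  | none => rw [Config.next, Config.jobs_arrive] at h2; omega
  | some s =>
    have hs : s ∈ c.busy := by simpa using he
    have := Finset.card_pos.2 ⟨s, hs⟩
    rw [Config.next, hc.jobs_depart hs] at h2
    simp only [Config.jobs] at h2; omega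

/-- The total rate of the running clocks. -/
def Config.totalRate (lam mu : ℝ) (c : Config n k) : ℝ :=
  ∑ e ∈ Finset.insertNone c.busy, eventRate lam mu e

theorem Config.totalRate_pos {lam mu : ℝ} (hlam : 0 < lam) (hmu : 0 < mu) (c : Config n k) :
    0 < c.totalRate lam mu :=
  Finset.sum_pos (fun e _ => eventRate_pos hlam hmu e) ⟨none, by simp⟩

theorem Config.Good.exitRate_state {c : Config n k} (hk : 1 ≤ k) (hc : c.Good t)
    (rule : AssignmentRule n k) (lam mu : ℝ) :
    exitRate (generator n k t lam mu) (c.state t) = c.totalRate lam mu := by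
  rw [exitRate, hc.generator_state hk rule, ← Finset.sum_neg_distrib, Config.totalRate]
  refine Finset.sum_congr rfl fun e he => ?_
  rw [if_neg (hc.state_next_ne hk rule he), if_pos rfl]
  ring

theorem Config.Good.jumpMatrix_state {c : Config n k} (hk : 1 ≤ k) (hc : c.Good t)
    (rule : AssignmentRule n k) {lam mu : ℝ} (hlam : 0 < lam) (hmu : 0 < mu) (y : QState k t) :
    jumpMatrix (generator n k t lam mu) (c.state t) y =
      ∑ e ∈ (Finset.insertNone c.busy).filter fun e => (c.next t rule e).state t = y,
        eventRate lam mu e / c.totalRate lam mu := by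
  rw [jumpMatrix, hc.exitRate_state hk rule, if_neg (c.totalRate_pos hlam hmu).ne']
  split_ifs with h
  · rw [Finset.filter_false_of_mem, Finset.sum_empty]
    intro e he h'
    exact hc.state_next_ne hk rule he (h'.trans h.symm)
  · rw [hc.generator_state hk rule, ← Finset.sum_div, Finset.sum_filter]
    congr 1
    refine Finset.sum_congr rfl fun e _ => ?_
    simp [h]

/-! ## The race of exponential clocks -/

/-- Memorylessness together with the law of the overshoot: translate by `x` and split the
exponential in the density. -/
theorem expMeasure_apply_lt_and_sub_mem {r x : ℝ} (hx : 0 ≤ x) {B : Set ℝ}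
    (hB : MeasurableSet B) :
    expMeasure r {a | x < a ∧ a - x ∈ B} =
      ENNReal.ofReal (Real.exp (-(r * x))) * expMeasure r B := by
  have hA : MeasurableSet {a : ℝ | x < a ∧ a - x ∈ B} :=
    (measurableSet_lt measurable_const measurable_id).inter (measurable_id.sub_const x hB)
  have hexp (C : Set ℝ) (hC : MeasurableSet C) :
      expMeasure r C = ∫⁻ a, C.indicator (exponentialPDF r) a := by
    rw [lintegral_indicator hC]
    exact withDensity_apply _ hC
  rw [hexp _ hA, hexp _ hB, ← lintegral_const_mul' _ _ ENNReal.ofReal_ne_top,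
    ← lintegral_add_right_eq_self _ x]
  refine lintegral_congr_ae ?_
  -- At `b = 0` the integrands can differ, since the inequality is strict and the density does not
  -- vanish there.
  filter_upwards [compl_mem_ae_iff.2 (measure_singleton (0 : ℝ))] with b hb
  rcases lt_or_gt_of_ne (show b ≠ 0 from hb) with hb | hb
  · have h : b + x ∉ {a : ℝ | x < a ∧ a - x ∈ B} := fun h => by
      have : x < b + x := h.1
      linarith
    rw [Set.indicator_of_notMem h]
    by_cases hbB : b ∈ B <;> simp [hbB, exponentialPDF_of_neg hb]
  · by_cases hbB : b ∈ B
    · have h : b + x ∈ {a : ℝ | x < a ∧ a - x ∈ B} := ⟨by linarith, by simpa using hbB⟩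
      rw [Set.indicator_of_mem h, Set.indicator_of_mem hbB,
        exponentialPDF_of_nonneg (by linarith), exponentialPDF_of_nonneg hb.le,
        ← ENNReal.ofReal_mul (Real.exp_pos _).le]
      congr 1
      rw [mul_add, neg_add, Real.exp_add]
      ring
    · simp [hbB]

theorem expMeasure_singleton (r x : ℝ) : expMeasure r {x} = 0 :=
  withDensity_absolutelyContinuous _ _ (measure_singleton x)

theorem expMeasure_apply_le_and_sub_mem {r x : ℝ} (hx : 0 ≤ x) {B : Set ℝ}
    (hB : MeasurableSet B) :
    expMeasure r {a | x ≤ a ∧ a - x ∈ B} =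
      ENNReal.ofReal (Real.exp (-(r * x))) * expMeasure r B := by
  rw [← expMeasure_apply_lt_and_sub_mem hx hB]
  refine measure_congr ?_
  have : {x}ᶜ ∈ ae (expMeasure r) := compl_mem_ae_iff.2 (expMeasure_singleton r x)
  filter_upwards [this] with a ha
  have hne : a ≠ x := ha
  refine propext (and_congr_left fun _ => ⟨fun h => lt_of_le_of_ne h hne.symm, fun h => le_of_lt h⟩)

theorem expMeasure_Ioi {r x : ℝ} (hr : 0 < r) (hx : 0 ≤ x) :
    expMeasure r (Set.Ioi x) = ENNReal.ofReal (Real.exp (-(r * x))) := by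
  have := isProbabilityMeasure_expMeasure hr
  simpa [Set.Ioi] using expMeasure_apply_lt_and_sub_mem (r := r) hx MeasurableSet.univ

/-- With `q` the total rate of the competing clocks, the integrand is the probability that they all
outlast `x`; the integral is the probability that the clock of rate `r` wins after time `s`. -/
theorem setLIntegral_expMeasure_exp {r q s : ℝ} (hr : 0 < r) (hq : 0 ≤ q) (hs : 0 ≤ s) :
    ∫⁻ x in Set.Ioi s, ENNReal.ofReal (Real.exp (-(q * x))) ∂expMeasure r =
      ENNReal.ofReal (Real.exp (-((r + q) * s)) * (r / (r + q))) := by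
  have hpdf (p : ℝ) : Measurable (exponentialPDF p) :=
    (measurable_exponentialPDFReal p).ennreal_ofReal
  have hrq : 0 < r + q := by linarith
  have h1 : ∫⁻ x in Set.Ioi s, ENNReal.ofReal (Real.exp (-(q * x))) ∂expMeasure r =
      ∫⁻ x in Set.Ioi s, ENNReal.ofReal (r / (r + q)) * exponentialPDF (r + q) x := by
    change ∫⁻ x in Set.Ioi s, ENNReal.ofReal (Real.exp (-(q * x)))
      ∂(volume.withDensity (exponentialPDF r)) = _
    rw [setLIntegral_withDensity_eq_setLIntegral_mul _ (hpdf r) (by fun_prop) measurableSet_Ioi]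
    refine setLIntegral_congr_fun measurableSet_Ioi fun x hx => ?_
    have hx0 : 0 ≤ x := hs.trans (le_of_lt hx)
    simp only [Pi.mul_apply]
    rw [exponentialPDF_of_nonneg hx0, exponentialPDF_of_nonneg hx0,
      ← ENNReal.ofReal_mul (by positivity), ← ENNReal.ofReal_mul (by positivity)]
    have : Real.exp (-((r + q) * x)) = Real.exp (-(r * x)) * Real.exp (-(q * x)) := by
      rw [← Real.exp_add]; ring_nf
    rw [this]
    congr 1
    field_simp
  rw [h1, lintegral_const_mul _ (hpdf _)]
  have h2 : ∫⁻ x in Set.Ioi s, exponentialPDF (r + q) x = expMeasure (r + q) (Set.Ioi s) :=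
    (withDensity_apply _ measurableSet_Ioi).symm
  rw [h2, expMeasure_Ioi hrq hs, ← ENNReal.ofReal_mul (by positivity), mul_comm]

section Pi

variable {ι : Type*}

theorem measurable_update_prod [DecidableEq ι] (e : ι) :
    Measurable fun p : ℝ × (ι → ℝ) => Function.update p.2 e p.1 := by
  refine measurable_pi_iff.2 fun i => ?_
  by_cases h : i = e
  · subst h; simpa using measurable_fst
  · simp only [Function.update_of_ne h]
    exact (measurable_pi_apply i).comp measurable_snd

/-- The clocks after the clock `e` has fired: those in `R` other than `e` keep running, the others
are replaced by `z`. -/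
def residual [DecidableEq ι] (R : Finset ι) (e : ι) (a z : ι → ℝ) : ι → ℝ :=
  fun f => if f ∈ R.erase e then a f - a e else z f

theorem measurable_residual [DecidableEq ι] (R : Finset ι) (e : ι) :
    Measurable fun p : (ι → ℝ) × (ι → ℝ) => residual R e p.1 p.2 := by
  refine measurable_pi_iff.2 fun f => ?_
  unfold residual
  split_ifs
  · exact ((measurable_pi_apply f).comp measurable_fst).sub
      ((measurable_pi_apply e).comp measurable_fst)
  · exact (measurable_pi_apply f).comp measurable_snd

variable [Fintype ι]

theorem eq_smul_pi (ν : ι → Measure ℝ) [∀ i, IsProbabilityMeasure (ν i)] {ρ : Measure (ι → ℝ)}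
    {κ : ℝ≥0∞} (hκ : κ ≠ ∞)
    (h : ∀ s : ι → Set ℝ, (∀ i, MeasurableSet (s i)) →
      ρ (Set.univ.pi s) = κ * ∏ i, ν i (s i)) : ρ = κ • Measure.pi ν := by
  by_cases h0 : κ = 0
  · have := h (fun _ => Set.univ) fun _ => MeasurableSet.univ
    rw [h0, zero_mul, Set.pi_univ, Measure.measure_univ_eq_zero] at this
    rw [this, h0, zero_smul]
  · have : κ⁻¹ • ρ = Measure.pi ν := by
      refine (Measure.pi_eq fun s hs => ?_).symm
      rw [Measure.smul_apply, h s hs, smul_eq_mul, ← mul_assoc, ENNReal.inv_mul_cancel h0 hκ,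
        one_mul]
    rw [← this, smul_smul, ENNReal.mul_inv_cancel h0 hκ, one_smul]

/-- The joint law of independent exponential clocks. -/
noncomputable def clockLaw (r : ι → ℝ) : Measure (ι → ℝ) := Measure.pi fun i => expMeasure (r i)

variable {r : ι → ℝ}

theorem isProbabilityMeasure_clockLaw (hr : ∀ i, 0 < r i) :
    IsProbabilityMeasure (clockLaw r) := by
  have (i : ι) := isProbabilityMeasure_expMeasure (hr i)
  unfold clockLaw; infer_instance

variable [DecidableEq ι]

/-- Resampling one coordinate independently preserves a product law. This allows conditioning on the
value of the clock `e` by Fubini. -/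
theorem map_update_prod_pi (ν : ι → Measure ℝ) [∀ i, IsProbabilityMeasure (ν i)] (e : ι) :
    ((ν e).prod (Measure.pi ν)).map (fun p => Function.update p.2 e p.1) = Measure.pi ν := by
  have hm := measurable_update_prod e
  refine (Measure.pi_eq fun s hs => ?_).symm
  rw [Measure.map_apply hm (MeasurableSet.univ_pi hs)]
  have : (fun p : ℝ × (ι → ℝ) => Function.update p.2 e p.1) ⁻¹' Set.univ.pi s =
      s e ×ˢ Set.univ.pi (Function.update s e Set.univ) := by
    ext ⟨x, a⟩
    simp only [Set.mem_preimage, Set.mem_univ_pi, Set.mem_prod]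
    constructor
    · intro h
      refine ⟨by simpa using h e, fun i => ?_⟩
      by_cases hi : i = e
      · subst hi; simp
      · simpa [Function.update_of_ne hi] using h i
    · rintro ⟨h1, h2⟩ i
      by_cases hi : i = e
      · subst hi; simpa using h1
      · simpa [Function.update_of_ne hi] using h2 i
  rw [this, Measure.prod_prod, Measure.pi_pi,
    ← Finset.mul_prod_erase Finset.univ _ (Finset.mem_univ e),
    ← Finset.mul_prod_erase Finset.univ (fun i => ν i (s i)) (Finset.mem_univ e)]
  simp only [Function.update_self, measure_univ, one_mul]
  congr 1
  refine Finset.prod_congr rfl fun i hi => ?_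
  rw [Function.update_of_ne (Finset.ne_of_mem_erase hi)]

/-- Here `x` is the value of the winning clock and `C` the ray beyond it. Keeping `C` abstract
treats the open and the closed ray at once; `hC` is memorylessness. -/
theorem clockLaw_slice (hr : ∀ i, 0 < r i) (R : Finset ι) {e : ι} {x : ℝ}
    {C : Set ℝ} {B : ι → Set ℝ}
    (hC : ∀ f, expMeasure (r f) {a | a ∈ C ∧ a - x ∈ B f} =
      ENNReal.ofReal (Real.exp (-(r f * x))) * expMeasure (r f) (B f)) :
    clockLaw r {a | ∀ f ∈ R.erase e, a f ∈ C ∧ a f - x ∈ B f} =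
      ENNReal.ofReal (Real.exp (-((∑ f ∈ R.erase e, r f) * x))) *
        ∏ f ∈ R.erase e, expMeasure (r f) (B f) := by
  have (i : ι) := isProbabilityMeasure_expMeasure (hr i)
  have h1 : {a : ι → ℝ | ∀ f ∈ R.erase e, a f ∈ C ∧ a f - x ∈ B f} =
      Set.univ.pi fun f => if f ∈ R.erase e then {y | y ∈ C ∧ y - x ∈ B f} else Set.univ := by
    ext a
    simp only [Set.mem_univ_pi, Set.mem_ofPred_eq]
    refine forall_congr' fun f => ?_
    split_ifs with h <;> simp [h]
  rw [h1, clockLaw, Measure.pi_pi]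
  simp only [apply_ite, measure_univ]
  rw [Finset.prod_ite_mem, Finset.univ_inter, Finset.prod_congr rfl fun f _ => hC f,
    Finset.prod_mul_distrib, ← ENNReal.ofReal_prod_of_nonneg fun _ _ => (Real.exp_pos _).le,
    ← Real.exp_sum, Finset.sum_neg_distrib, Finset.sum_mul]

theorem clockLaw_race (hr : ∀ i, 0 < r i) (R : Finset ι) {e : ι} (he : e ∈ R) {s : ℝ}
    (hs : 0 ≤ s) {C : ℝ → Set ℝ} (hCm : MeasurableSet {p : ℝ × ℝ | p.2 ∈ C p.1}) {B : ι → Set ℝ}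
    (hB : ∀ f, MeasurableSet (B f))
    (hC : ∀ f x, 0 ≤ x → expMeasure (r f) {a | a ∈ C x ∧ a - x ∈ B f} =
      ENNReal.ofReal (Real.exp (-(r f * x))) * expMeasure (r f) (B f)) :
    clockLaw r {a | s < a e ∧ ∀ f ∈ R.erase e, a f ∈ C (a e) ∧ a f - a e ∈ B f} =
      ENNReal.ofReal (Real.exp (-((∑ f ∈ R, r f) * s)) * (r e / ∑ f ∈ R, r f)) *
        ∏ f ∈ R.erase e, expMeasure (r f) (B f) := by
  have (i : ι) := isProbabilityMeasure_expMeasure (hr i)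
  have hS : MeasurableSet
      {a : ι → ℝ | s < a e ∧ ∀ f ∈ R.erase e, a f ∈ C (a e) ∧ a f - a e ∈ B f} := by
    have : {a : ι → ℝ | s < a e ∧ ∀ f ∈ R.erase e, a f ∈ C (a e) ∧ a f - a e ∈ B f} =
        {a | s < a e} ∩ ⋂ f ∈ R.erase e, ({a | a f ∈ C (a e)} ∩ {a | a f - a e ∈ B f}) := by
      ext a; simp
    rw [this]
    refine (measurableSet_lt measurable_const (measurable_pi_apply e)).inter
      (Finset.measurableSet_biInter _ fun f _ => MeasurableSet.inter ?_ ?_)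
    · have h : Measurable fun a : ι → ℝ => (a e, a f) :=
        (measurable_pi_apply e).prodMk (measurable_pi_apply f)
      exact h hCm
    · exact ((measurable_pi_apply f).sub (measurable_pi_apply e)) (hB f)
  have hm := measurable_update_prod e
  have hslice (x : ℝ) : Prod.mk x ⁻¹' ((fun p : ℝ × (ι → ℝ) => Function.update p.2 e p.1) ⁻¹'
      {a : ι → ℝ | s < a e ∧ ∀ f ∈ R.erase e, a f ∈ C (a e) ∧ a f - a e ∈ B f}) =
      {a | s < x ∧ ∀ f ∈ R.erase e, a f ∈ C x ∧ a f - x ∈ B f} := by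
    ext a
    simp only [Set.mem_preimage, Set.mem_ofPred_eq, Function.update_self]
    refine and_congr_right fun _ => forall₂_congr fun f hf => ?_
    rw [Function.update_of_ne (Finset.ne_of_mem_erase hf)]
  rw [clockLaw, ← map_update_prod_pi _ e, Measure.map_apply hm hS,
    Measure.prod_apply (hm hS)]
  simp only [hslice]
  have hind (x : ℝ) : (Measure.pi fun i => expMeasure (r i))
      {a | s < x ∧ ∀ f ∈ R.erase e, a f ∈ C x ∧ a f - x ∈ B f} =
      (Set.Ioi s).indicator (fun x => ENNReal.ofReal (Real.exp (-((∑ f ∈ R.erase e, r f) * x))) *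
        ∏ f ∈ R.erase e, expMeasure (r f) (B f)) x := by
    by_cases hx : s < x
    · rw [Set.indicator_of_mem (show x ∈ Set.Ioi s from hx),
        ← clockLaw_slice hr R fun f => hC f x (hs.trans hx.le)]
      simp [hx, clockLaw]
    · rw [Set.indicator_of_notMem (show x ∉ Set.Ioi s from hx)]
      simp [hx]
  simp only [hind]
  have hq : 0 ≤ ∑ f ∈ R.erase e, r f := Finset.sum_nonneg fun f _ => (hr f).le
  rw [lintegral_indicator measurableSet_Ioi, lintegral_mul_const _ (by fun_prop),
    setLIntegral_expMeasure_exp (hr e) hq hs, Finset.add_sum_erase _ _ he]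

/-- Running clocks contribute their overshoots and all other coordinates a fresh sample, so every
coordinate has its factor and the full product law reappears. -/
theorem clockLaw_prod_residual_of_pi (hr : ∀ i, 0 < r i) (R : Finset ι) {e : ι} (he : e ∈ R)
    {s : ℝ} (hs : 0 ≤ s) {C : ℝ → Set ℝ} (hCm : MeasurableSet {p : ℝ × ℝ | p.2 ∈ C p.1})
    {B : ι → Set ℝ} (hB : ∀ f, MeasurableSet (B f))
    (hC : ∀ f x, 0 ≤ x → expMeasure (r f) {a | a ∈ C x ∧ a - x ∈ B f} =
      ENNReal.ofReal (Real.exp (-(r f * x))) * expMeasure (r f) (B f)) :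
    ((clockLaw r).prod (clockLaw r)) {p | (∀ f ∈ R.erase e, p.1 f ∈ C (p.1 e)) ∧ s < p.1 e ∧
        residual R e p.1 p.2 ∈ Set.univ.pi B} =
      ENNReal.ofReal (Real.exp (-((∑ f ∈ R, r f) * s)) * (r e / ∑ f ∈ R, r f)) *
        ∏ f, expMeasure (r f) (B f) := by
  have (i : ι) := isProbabilityMeasure_expMeasure (hr i)
  have := isProbabilityMeasure_clockLaw hr
  have h1 : {p : (ι → ℝ) × (ι → ℝ) | (∀ f ∈ R.erase e, p.1 f ∈ C (p.1 e)) ∧ s < p.1 e ∧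
        residual R e p.1 p.2 ∈ Set.univ.pi B} =
      {a | s < a e ∧ ∀ f ∈ R.erase e, a f ∈ C (a e) ∧ a f - a e ∈ B f} ×ˢ
        Set.univ.pi fun f => if f ∈ (R.erase e)ᶜ then B f else Set.univ := by
    ext ⟨a, z⟩
    simp only [Set.mem_ofPred_eq, Set.mem_prod, Set.mem_univ_pi, residual]
    constructor
    · rintro ⟨h1, h2, h3⟩
      refine ⟨⟨h2, fun f hf => ⟨h1 f hf, by simpa [hf] using h3 f⟩⟩, fun f => ?_⟩
      split_ifs with hf
      · rw [Finset.mem_compl] at hf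
        simpa [hf] using h3 f
      · trivial
    · rintro ⟨⟨h2, h1⟩, h3⟩
      refine ⟨fun f hf => (h1 f hf).1, h2, fun f => ?_⟩
      split_ifs with hf
      · exact (h1 f hf).2
      · have := h3 f
        rwa [if_pos (Finset.mem_compl.2 hf)] at this
  have h2 : clockLaw r (Set.univ.pi fun f => if f ∈ (R.erase e)ᶜ then B f else Set.univ) =
      ∏ f ∈ (R.erase e)ᶜ, expMeasure (r f) (B f) := by
    rw [clockLaw, Measure.pi_pi]
    simp only [apply_ite, measure_univ]
    rw [Finset.prod_ite_mem, Finset.univ_inter]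
  rw [h1, Measure.prod_prod, clockLaw_race hr R he hs hCm hB hC, h2, mul_assoc,
    Finset.prod_mul_prod_compl]

/-- `S` is the event that `e` fires under some rule for ties, squeezed by `hlt` and `hle` between
strict and weak victory. On boxes both bounds have the same probability because exponential laws
have no atoms; boxes determine the measure. -/
theorem clockLaw_prod_residual (hr : ∀ i, 0 < r i) (R : Finset ι) {e : ι} (he : e ∈ R)
    {s : ℝ} (hs : 0 ≤ s) {S : Set (ι → ℝ)} (hS : MeasurableSet S)
    (hlt : ∀ a, (∀ f ∈ R.erase e, a e < a f) → a ∈ S) (hle : ∀ a ∈ S, ∀ f ∈ R, a e ≤ a f)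
    {B : Set (ι → ℝ)} (hB : MeasurableSet B) :
    ((clockLaw r).prod (clockLaw r)) {p | p.1 ∈ S ∧ s < p.1 e ∧ residual R e p.1 p.2 ∈ B} =
      ENNReal.ofReal (Real.exp (-((∑ f ∈ R, r f) * s)) * (r e / ∑ f ∈ R, r f)) *
        clockLaw r B := by
  have (i : ι) := isProbabilityMeasure_expMeasure (hr i)
  have := isProbabilityMeasure_clockLaw hr
  have hT : MeasurableSet {p : (ι → ℝ) × (ι → ℝ) | p.1 ∈ S ∧ s < p.1 e} :=
    (measurable_fst hS).inter (measurableSet_lt measurable_const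
      ((measurable_pi_apply e).comp measurable_fst))
  have hmap (B : Set (ι → ℝ)) (hB : MeasurableSet B) :
      ((((clockLaw r).prod (clockLaw r)).restrict {p | p.1 ∈ S ∧ s < p.1 e}).map
        fun p => residual R e p.1 p.2) B =
      ((clockLaw r).prod (clockLaw r)) {p | p.1 ∈ S ∧ s < p.1 e ∧ residual R e p.1 p.2 ∈ B} := by
    rw [Measure.map_apply (measurable_residual R e) hB,
      Measure.restrict_apply (measurable_residual R e hB)]
    congr 1
    ext p
    simp only [Set.mem_inter_iff, Set.mem_preimage, Set.mem_ofPred_eq]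
    tauto
  rw [← hmap B hB]
  refine congrArg (fun ρ : Measure (ι → ℝ) => ρ B)
    (eq_smul_pi (fun i => expMeasure (r i)) ENNReal.ofReal_ne_top fun B hB => ?_)
  rw [hmap _ (MeasurableSet.univ_pi hB)]
  refine le_antisymm ?_ ?_
  · rw [← clockLaw_prod_residual_of_pi hr R he hs (C := Set.Ici)
      (measurableSet_le measurable_fst measurable_snd) hB
      fun f x hx => expMeasure_apply_le_and_sub_mem hx (hB f)]
    exact measure_mono fun p hp => ⟨fun f hf => hle _ hp.1 f (Finset.mem_of_mem_erase hf), hp.2⟩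
  · rw [← clockLaw_prod_residual_of_pi hr R he hs (C := Set.Ioi)
      (measurableSet_lt measurable_fst measurable_snd) hB
      fun f x hx => expMeasure_apply_lt_and_sub_mem hx (hB f)]
    exact measure_mono fun p hp => ⟨hlt _ hp.1, hp.2⟩

end Pi

/-! ## The steps of the queue -/

theorem Snapshot.firing_mem_and_le (x : Snapshot n k) :
    x.firing ∈ x.running ∧ ∀ f ∈ x.running, x.clock x.firing ≤ x.clock f := by
  cases h : x.firing with
  | some s =>
    have := List.find?_some h
    simp only [decide_eq_true_eq] at this
    exact ⟨by simpa [Snapshot.running] using this.1, this.2⟩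
  | none =>
    refine ⟨by simp [Snapshot.running], ?_⟩
    obtain ⟨e, he, hmin⟩ := x.running.exists_min_image x.clock ⟨none, by simp [Snapshot.running]⟩
    cases e with
    | none => exact hmin
    | some s =>
      have := List.find?_eq_none.1 h s (List.mem_finRange s)
      simp only [decide_eq_true_eq] at this
      exact absurd ⟨by simpa [Snapshot.running] using he, hmin⟩ this

theorem Snapshot.firing_eq_of_lt {x : Snapshot n k} {e : Event n}
    (h : ∀ f ∈ x.running.erase e, x.clock e < x.clock f) (he : e ∈ x.running) : x.firing = e := by
  by_contra hne
  have h1 := h _ (Finset.mem_erase.2 ⟨hne, x.firing_mem_and_le.1⟩)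
  exact absurd (x.firing_mem_and_le.2 e he) (not_le.2 h1)

theorem measurableSet_find?_eq {α β : Type*} [MeasurableSpace α] (p : β → α → Prop)
    [∀ b a, Decidable (p b a)] (hp : ∀ b, MeasurableSet {a | p b a}) (l : List β) (e : Option β) :
    MeasurableSet {a | (l.find? fun b => decide (p b a)) = e} := by
  induction l with
  | nil => simp
  | cons b l ih =>
    have : {a | ((b :: l).find? fun b => decide (p b a)) = e} =
        ({a | p b a} ∩ {_a | some b = e}) ∪
          ({a | p b a}ᶜ ∩ {a | (l.find? fun b => decide (p b a)) = e}) := by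
      ext a
      by_cases h : p b a <;> simp [List.find?_cons, h]
    rw [this]
    exact ((hp b).inter (MeasurableSet.const _)).union ((hp b).compl.inter ih)

open Classical in
theorem measurableSet_firing_eq (c : Config n k) (e : Event n) :
    MeasurableSet {a | (⟨c, a⟩ : Snapshot n k).firing = e} := by
  refine measurableSet_find?_eq (fun s (a : Event n → ℝ) => s ∈ c.busy ∧
    ∀ f ∈ Finset.insertNone c.busy, a (some s) ≤ a f) (fun s => ?_) _ e
  have : {a : Event n → ℝ | s ∈ c.busy ∧ ∀ f ∈ Finset.insertNone c.busy, a (some s) ≤ a f} =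
      {_a | s ∈ c.busy} ∩ ⋂ f ∈ Finset.insertNone c.busy, {a | a (some s) ≤ a f} := by
    ext a
    simp only [Set.mem_ofPred_eq, Set.mem_inter_iff, Set.mem_iInter]
  rw [this]
  exact (MeasurableSet.const _).inter (Finset.measurableSet_biInter _ fun f _ =>
    measurableSet_le (measurable_pi_apply _) (measurable_pi_apply _))

theorem Snapshot.clock_step (rule : AssignmentRule n k) (z : Event n → ℝ) (x : Snapshot n k) :
    (x.step t rule z).clock = residual x.running x.firing x.clock z := by
  funext f
  simp only [Snapshot.step, residual, Snapshot.holding, Finset.mem_erase]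
  by_cases h1 : f = x.firing <;> by_cases h2 : f ∈ x.running <;> simp [h1, h2]

theorem good_snapshot (hk : 1 ≤ k) (rule : AssignmentRule n k) (ξ : ℕ → Event n → ℝ) (N : ℕ) :
    (snapshot t rule ξ N).config.Good t := by
  induction N with
  | zero => exact Config.good_empty
  | succ N ih => exact ih.next hk rule (Snapshot.firing_mem_and_le _).1

instance : Countable (Batch n k) := by
  refine Function.Injective.countable (f := fun b : Batch n k => (b.waiting, b.served)) ?_
  rintro ⟨w, hw, S⟩ ⟨w', hw', S'⟩ h
  simp only [Prod.mk.injEq] at h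
  obtain ⟨rfl, rfl⟩ := h
  rfl

instance : Countable (Config n k) := by
  refine Function.Injective.countable (f := fun c : Config n k => (c.busy, c.buffer)) ?_
  rintro ⟨b, q⟩ ⟨b', q'⟩ h
  simp only [Prod.mk.injEq] at h
  obtain ⟨rfl, rfl⟩ := h
  rfl

/-! ## Measurability -/

theorem measurable_of_countable_cover {Ω β ι : Type*} [MeasurableSpace Ω] [MeasurableSpace β]
    [Countable ι] {A : ι → Set Ω} (hA : ∀ i, MeasurableSet (A i)) (hcover : ∀ ω, ∃ i, ω ∈ A i)
    {f : Ω → β} {g : ι → Ω → β} (hg : ∀ i, Measurable (g i)) (h : ∀ i, ∀ ω ∈ A i, f ω = g i ω) :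
    Measurable f := by
  intro B hB
  have : f ⁻¹' B = ⋃ i, A i ∩ g i ⁻¹' B := by
    ext ω
    simp only [Set.mem_preimage, Set.mem_iUnion, Set.mem_inter_iff]
    constructor
    · intro hω
      obtain ⟨i, hi⟩ := hcover ω
      exact ⟨i, hi, by rwa [← h i ω hi]⟩
    · rintro ⟨i, hi, hω⟩
      rwa [h i ω hi]
  rw [this]
  exact MeasurableSet.iUnion fun i => (hA i).inter (hg i hB)

theorem measurableSet_mem_of_fibers {Ω γ : Type*} [MeasurableSpace Ω] [Countable γ] {g : Ω → γ}
    (hg : ∀ c, MeasurableSet {ω | g ω = c}) (S : Set γ) : MeasurableSet {ω | g ω ∈ S} := by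
  have : {ω | g ω ∈ S} = ⋃ c ∈ S, {ω | g ω = c} := by
    ext ω; simp
  rw [this]
  exact MeasurableSet.biUnion S.to_countable fun c _ => hg c

section Clocks

variable {Ω : Type*}

/-- The random state of the system after `N` events. -/
noncomputable def randomSnapshot (t : ℕ) (rule : AssignmentRule n k) (ξ : ℕ → Event n → Ω → ℝ)
    (N : ℕ) (ω : Ω) : Snapshot n k :=
  snapshot t rule (fun i f => ξ i f ω) N

/-- The configuration after `N` events is `c`, and the next event is `e`. -/
def fiber (t : ℕ) (rule : AssignmentRule n k) (ξ : ℕ → Event n → Ω → ℝ) (N : ℕ)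
    (c : Config n k) (e : Event n) : Set Ω :=
  {ω | (randomSnapshot t rule ξ N ω).config = c ∧ (randomSnapshot t rule ξ N ω).firing = e}

variable {rule : AssignmentRule n k} {ξ : ℕ → Event n → Ω → ℝ} {N : ℕ} {c : Config n k}
  {e : Event n}

theorem config_succ_of_mem_fiber {ω : Ω} (h : ω ∈ fiber t rule ξ N c e) :
    (randomSnapshot t rule ξ (N + 1) ω).config = c.next t rule e := by
  rw [← h.1, ← h.2]; rfl

theorem clock_succ_of_mem_fiber {ω : Ω} (h : ω ∈ fiber t rule ξ N c e) :
    (randomSnapshot t rule ξ (N + 1) ω).clock =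
      residual (Finset.insertNone c.busy) e (randomSnapshot t rule ξ N ω).clock
        (fun f => ξ (N + 1) f ω) := by
  rw [← h.1, ← h.2]
  exact Snapshot.clock_step _ _ _

theorem holding_of_mem_fiber {ω : Ω} (h : ω ∈ fiber t rule ξ N c e) :
    (randomSnapshot t rule ξ N ω).holding = (randomSnapshot t rule ξ N ω).clock e := by
  rw [← h.2]; rfl

theorem fiber_eq : fiber t rule ξ N c e = {ω | (randomSnapshot t rule ξ N ω).config = c} ∩
    {ω | (randomSnapshot t rule ξ N ω).clock ∈ {a | (⟨c, a⟩ : Snapshot n k).firing = e}} := by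
  ext ω
  refine and_congr_right fun h => ?_
  rw [Set.mem_ofPred_eq, Set.mem_ofPred_eq, ← h]

/-- Only the samples up to `N` are assumed measurable, so the result also applies with `pastClocks ξ
N` as the σ-algebra on `Ω`, where it expresses adaptedness. -/
theorem measurable_randomSnapshot [MeasurableSpace Ω] (N : ℕ)
    (h : ∀ i ≤ N, ∀ f, Measurable (ξ i f)) :
    (∀ c, MeasurableSet {ω | (randomSnapshot t rule ξ N ω).config = c}) ∧
      Measurable fun ω => (randomSnapshot t rule ξ N ω).clock := by
  induction N with
  | zero =>
    refine ⟨fun c => ?_, measurable_pi_iff.2 fun f => h 0 le_rfl f⟩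
    exact MeasurableSet.const ((⟨∅, []⟩ : Config n k) = c)
  | succ N ih =>
    obtain ⟨h1, h2⟩ := ih fun i hi f => h i (by omega) f
    have hfiber (p : Config n k × Event n) : MeasurableSet (fiber t rule ξ N p.1 p.2) := by
      rw [fiber_eq]
      exact (h1 _).inter (h2 (measurableSet_firing_eq _ _))
    have hcover (ω : Ω) : ∃ p : Config n k × Event n, ω ∈ fiber t rule ξ N p.1 p.2 :=
      ⟨(_, _), rfl, rfl⟩
    refine ⟨fun c => ?_, ?_⟩
    · have : {ω | (randomSnapshot t rule ξ (N + 1) ω).config = c} =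
          ⋃ p ∈ {p : Config n k × Event n | p.1.next t rule p.2 = c},
            fiber t rule ξ N p.1 p.2 := by
        ext ω
        simp only [Set.mem_iUnion, Set.mem_ofPred_eq, exists_prop]
        constructor
        · intro hω
          obtain ⟨p, hp⟩ := hcover ω
          exact ⟨p, by rw [← config_succ_of_mem_fiber hp, hω], hp⟩
        · rintro ⟨p, rfl, hp⟩
          exact config_succ_of_mem_fiber hp
      rw [this]
      exact MeasurableSet.biUnion (Set.to_countable _) fun p _ => hfiber p
    · have hξ : Measurable fun ω f => ξ (N + 1) f ω :=
        measurable_pi_iff.2 fun f => h (N + 1) le_rfl f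
      exact measurable_of_countable_cover hfiber hcover
        (fun p => (measurable_residual (Finset.insertNone p.1.busy) p.2).comp (h2.prodMk hξ))
        fun p ω hω => clock_succ_of_mem_fiber hω

theorem measurableSet_fiber [MeasurableSpace Ω] (h : ∀ i ≤ N, ∀ f, Measurable (ξ i f)) :
    MeasurableSet (fiber t rule ξ N c e) := by
  obtain ⟨h1, h2⟩ := measurable_randomSnapshot (t := t) (rule := rule) N h
  rw [fiber_eq]
  exact (h1 _).inter (h2 (measurableSet_firing_eq _ _))

theorem measurable_holding [MeasurableSpace Ω] (h : ∀ i ≤ N, ∀ f, Measurable (ξ i f)) :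
    Measurable fun ω => (randomSnapshot t rule ξ N ω).holding :=
  measurable_of_countable_cover
    (A := fun p : Config n k × Event n => fiber t rule ξ N p.1 p.2)
    (fun _ => measurableSet_fiber h) (fun _ => ⟨(_, _), rfl, rfl⟩)
    (fun p => (measurable_pi_apply p.2).comp (measurable_randomSnapshot N h).2)
    fun _ _ hω => holding_of_mem_fiber hω

theorem measurableSet_config_mem [MeasurableSpace Ω] (h : ∀ i ≤ N, ∀ f, Measurable (ξ i f))
    (S : Set (Config n k)) : MeasurableSet {ω | (randomSnapshot t rule ξ N ω).config ∈ S} :=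
  measurableSet_mem_of_fibers (measurable_randomSnapshot N h).1 S

/-! ### Histories of the reduced process -/

/-- The first `N + 1` reduced states are `y 0, …, y N`, and the first `N` holding times exceed
`s 0, …, s (N - 1)`. -/
def history (t : ℕ) (rule : AssignmentRule n k) (ξ : ℕ → Event n → Ω → ℝ) (y : ℕ → QState k t)
    (s : ℕ → ℝ≥0) (N : ℕ) : Set Ω :=
  {ω | (∀ i ≤ N, (randomSnapshot t rule ξ i ω).config.state t = y i) ∧
    ∀ i < N, (s i : ℝ) < (randomSnapshot t rule ξ i ω).holding}

variable {y : ℕ → QState k t} {s : ℕ → ℝ≥0}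

theorem history_succ : history t rule ξ y s (N + 1) = history t rule ξ y s N ∩
    {ω | (s N : ℝ) < (randomSnapshot t rule ξ N ω).holding ∧
      (randomSnapshot t rule ξ (N + 1) ω).config.state t = y (N + 1)} := by
  ext ω
  simp only [history, Set.mem_inter_iff, Set.mem_ofPred_eq, Nat.le_succ_iff_eq_or_le,
    Nat.lt_succ_iff_lt_or_eq, or_imp, forall_and, forall_eq]
  tauto

theorem measurableSet_history [MeasurableSpace Ω] (h : ∀ i ≤ N, ∀ f, Measurable (ξ i f)) :
    MeasurableSet (history t rule ξ y s N) := by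
  have : history t rule ξ y s N =
      (⋂ i ∈ Set.Iic N, {ω | (randomSnapshot t rule ξ i ω).config ∈ {c | c.state t = y i}}) ∩
        ⋂ i ∈ Set.Iio N, {ω | (s i : ℝ) < (randomSnapshot t rule ξ i ω).holding} := by
    ext ω
    simp [history]
  rw [this]
  refine (MeasurableSet.biInter (Set.to_countable _) fun i hi => ?_).inter
    (MeasurableSet.biInter (Set.to_countable _) fun i hi => ?_)
  · exact measurableSet_config_mem (fun j hj => h j (hj.trans hi)) _
  · exact measurableSet_lt measurable_const
      (measurable_holding fun j hj => h j (hj.trans (le_of_lt hi)))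

/-! ## The Markov property -/

theorem measure_eq_tsum_inter_fiber [MeasurableSpace Ω] (P : Measure Ω)
    (h : ∀ i f, Measurable (ξ i f)) (N : ℕ) (E : Set Ω) (hE : MeasurableSet E) :
    P E = ∑' c, ∑ e, P (E ∩ fiber t rule ξ N c e) := by
  have hE' : E = ⋃ p : Config n k × Event n, E ∩ fiber t rule ξ N p.1 p.2 := by
    rw [← Set.inter_iUnion, eq_comm, Set.inter_eq_left]
    exact fun ω _ => Set.mem_iUnion.2 ⟨(_, _), rfl, rfl⟩
  conv_lhs => rw [hE']
  rw [measure_iUnion, ENNReal.tsum_prod']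
  · simp only [tsum_fintype]
  · intro p p' hne
    refine Set.disjoint_left.2 fun ω h1 h2 => hne ?_
    exact Prod.ext (h1.2.1.symm.trans h2.2.1) (h1.2.2.symm.trans h2.2.2)
  · exact fun p => hE.inter (measurableSet_fiber fun i _ => h i)

end Clocks

section Markov

variable {Ω : Type*} [MeasurableSpace Ω] {P : Measure Ω} [IsProbabilityMeasure P]
  {rule : AssignmentRule n k} {ξ : ℕ → Event n → Ω → ℝ} {N : ℕ} {lam mu : ℝ}
  {y : ℕ → QState k t} {s : ℕ → ℝ≥0}

theorem IsInput.map_eq_clockLaw (hξ : IsInput P lam mu ξ) (N : ℕ) :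
    P.map (fun ω f => ξ N f ω) = clockLaw (eventRate lam mu) := by
  have h : iIndepFun (fun f => ξ N f) P :=
    hξ.indep.precomp (g := fun f : Event n => (N, f)) (Prod.mk_right_injective N)
  rw [(iIndepFun_iff_map_fun_eq_pi_map fun f => (hξ.measurable N f).aemeasurable).1 h, clockLaw]
  congr 1
  funext f
  cases f with
  | none => exact hξ.interarrival N
  | some s => exact hξ.service N s

/-- The information contained in the clocks set up to the event number `N`. -/
abbrev pastClocks (ξ : ℕ → Event n → Ω → ℝ) (N : ℕ) : MeasurableSpace Ω :=
  ⨆ p ∈ {p : ℕ × Event n | p.1 ≤ N}, MeasurableSpace.comap (ξ p.1 p.2) inferInstance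

omit [MeasurableSpace Ω] in
theorem measurable_pastClocks {i : ℕ} (hi : i ≤ N) (f : Event n) :
    Measurable[pastClocks ξ N] (ξ i f) :=
  Measurable.mono (comap_measurable (ξ i f))
    (le_iSup₂ (f := fun (p : ℕ × Event n) (_ : p ∈ {p : ℕ × Event n | p.1 ≤ N}) =>
      MeasurableSpace.comap (ξ p.1 p.2) inferInstance) (i, f) hi) le_rfl

omit [IsProbabilityMeasure P] in
theorem IsInput.pastClocks_le (hξ : IsInput P lam mu ξ) (N : ℕ) :
    pastClocks ξ N ≤ ‹MeasurableSpace Ω› :=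
  iSup₂_le fun p _ => (hξ.measurable p.1 p.2).comap_le

theorem IsInput.measure_inter_fresh (hξ : IsInput P lam mu ξ) {D : Set Ω}
    (hD : MeasurableSet[pastClocks ξ N] D) {Z : Set (Event n → ℝ)} (hZ : MeasurableSet Z) :
    P (D ∩ {ω | (fun f => ξ (N + 1) f ω) ∈ Z}) = P D * clockLaw (eventRate lam mu) Z := by
  have hdisj : Disjoint {p : ℕ × Event n | p.1 ≤ N} {p | p.1 = N + 1} := by
    refine Set.disjoint_left.2 fun p h1 h2 => ?_
    simp only [Set.mem_ofPred_eq] at h1 h2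
    omega
  have hind := indep_iSup_of_disjoint
    (m := fun p : ℕ × Event n => MeasurableSpace.comap (ξ p.1 p.2) inferInstance)
    (fun p => (hξ.measurable p.1 p.2).comap_le) hξ.indep hdisj
  have hm : Measurable[⨆ p ∈ {p : ℕ × Event n | p.1 = N + 1},
      MeasurableSpace.comap (ξ p.1 p.2) inferInstance] fun ω f => ξ (N + 1) f ω := by
    refine @measurable_pi_lambda _ _ _ (_) _ _ fun f => ?_
    exact Measurable.mono (comap_measurable (ξ (N + 1) f))
      (le_iSup₂ (f := fun (p : ℕ × Event n) (_ : p ∈ {p : ℕ × Event n | p.1 = N + 1}) =>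
        MeasurableSpace.comap (ξ p.1 p.2) inferInstance) (N + 1, f) rfl) le_rfl
  refine ((Indep_iff _ _ _).1 hind _ _ hD (hm hZ)).trans ?_
  rw [← hξ.map_eq_clockLaw (N + 1),
    Measure.map_apply (measurable_pi_iff.2 fun f => hξ.measurable (N + 1) f) hZ]

omit [IsProbabilityMeasure P] in
theorem IsInput.measurableSet_history (hξ : IsInput P lam mu ξ) :
    MeasurableSet (history t rule ξ y s N) :=
  MkMn.measurableSet_history fun i _ => hξ.measurable i

/-- On the past event `D` the present clocks have the law `clockLaw` up to the mass `P D`, and the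
samples of the next event are independent of the past. Their joint law is thus a product, to which
`clockLaw_prod_residual` applies. -/
theorem IsInput.measure_fiber_step (hξ : IsInput P lam mu ξ) (hlam : 0 < lam) (hmu : 0 < mu)
    {c : Config n k} {D : Set Ω} (hD : MeasurableSet[pastClocks ξ N] D)
    (hDc : ∀ ω ∈ D, (randomSnapshot t rule ξ N ω).config = c)
    (hclock : ∀ B, MeasurableSet B →
      P (D ∩ {ω | (randomSnapshot t rule ξ N ω).clock ∈ B}) =
        P D * clockLaw (eventRate lam mu) B)
    {e : Event n} (he : e ∈ Finset.insertNone c.busy) (u : ℝ≥0)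
    {B : Set (Event n → ℝ)} (hB : MeasurableSet B) :
    P (D ∩ {ω | (randomSnapshot t rule ξ N ω).firing = e ∧
        (u : ℝ) < (randomSnapshot t rule ξ N ω).holding ∧
        (randomSnapshot t rule ξ (N + 1) ω).clock ∈ B}) =
      P D * (ENNReal.ofReal (Real.exp (-(c.totalRate lam mu * u)) *
        (eventRate lam mu e / c.totalRate lam mu)) * clockLaw (eventRate lam mu) B) := by
  have hpos := eventRate_pos (n := n) hlam hmu
  have hprob := isProbabilityMeasure_clockLaw hpos
  have hle := hξ.pastClocks_le N
  have hX : Measurable[pastClocks ξ N] fun ω => (randomSnapshot t rule ξ N ω).clock :=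
    (@measurable_randomSnapshot n k t Ω rule ξ (pastClocks ξ N) N
      fun i hi f => measurable_pastClocks hi f).2
  have hX' : Measurable fun ω => (randomSnapshot t rule ξ N ω).clock := hX.mono hle le_rfl
  have hZ : Measurable fun ω f => ξ (N + 1) f ω :=
    measurable_pi_iff.2 fun f => hξ.measurable (N + 1) f
  have hmap : (P.restrict D).map (fun ω => (randomSnapshot t rule ξ N ω).clock) =
      P D • clockLaw (eventRate lam mu) := by
    ext B hB
    rw [Measure.map_apply hX' hB, Measure.restrict_apply (hX' hB), Set.inter_comm]
    exact hclock B hB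
  have hjoint : (P.restrict D).map
      (fun ω => ((randomSnapshot t rule ξ N ω).clock, fun f => ξ (N + 1) f ω)) =
      P D • ((clockLaw (eventRate lam mu)).prod (clockLaw (eventRate lam mu))) := by
    rw [← Measure.prod_smul_left, ← hmap]
    refine (Measure.prod_eq fun S T hS hT => ?_).symm
    rw [Measure.map_apply (hX'.prodMk hZ) (hS.prod hT), Measure.map_apply hX' hS,
      Measure.restrict_apply ((hX'.prodMk hZ) (hS.prod hT)), Measure.restrict_apply (hX' hS),
      Set.inter_comm _ D, Set.inter_comm _ D,
      ← hξ.measure_inter_fresh (MeasurableSet.inter hD (hX hS)) hT, Set.inter_assoc]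
    rfl
  have hS := measurableSet_firing_eq c e
  have hT : MeasurableSet {p : (Event n → ℝ) × (Event n → ℝ) |
      p.1 ∈ {a | (⟨c, a⟩ : Snapshot n k).firing = e} ∧ (u : ℝ) < p.1 e ∧
        residual (Finset.insertNone c.busy) e p.1 p.2 ∈ B} :=
    (measurable_fst hS).inter ((measurableSet_lt measurable_const
      ((measurable_pi_apply e).comp measurable_fst)).inter (measurable_residual _ e hB))
  have hrace := clockLaw_prod_residual hpos (Finset.insertNone c.busy) he u.2 hS
    (fun a ha => Snapshot.firing_eq_of_lt (x := ⟨c, a⟩) ha he)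
    (fun a ha f hf => by
      have := (Snapshot.firing_mem_and_le ⟨c, a⟩).2 f hf
      rwa [show Snapshot.firing ⟨c, a⟩ = e from ha] at this) hB
  have key := congrArg (fun ρ : Measure ((Event n → ℝ) × (Event n → ℝ)) =>
    ρ {p | p.1 ∈ {a | (⟨c, a⟩ : Snapshot n k).firing = e} ∧ (u : ℝ) < p.1 e ∧
        residual (Finset.insertNone c.busy) e p.1 p.2 ∈ B}) hjoint
  simp only [Measure.smul_apply, smul_eq_mul] at key
  rw [Config.totalRate]
  refine Eq.trans ?_ (key.trans (congrArg (P D * ·) hrace))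
  rw [Measure.map_apply (hX'.prodMk hZ) hT, Measure.restrict_apply ((hX'.prodMk hZ) hT),
    Set.inter_comm _ D]
  congr 1
  ext ω
  refine and_congr_right fun hω => ?_
  have hc := hDc ω hω
  simp only [Set.mem_ofPred_eq, Set.mem_preimage]
  have h1 : (⟨c, (randomSnapshot t rule ξ N ω).clock⟩ : Snapshot n k) =
      randomSnapshot t rule ξ N ω := by rw [← hc]
  rw [h1]
  refine and_congr_right fun hfire => ?_
  have hmem : ω ∈ fiber t rule ξ N c e := ⟨hc, hfire⟩
  rw [holding_of_mem_fiber hmem, clock_succ_of_mem_fiber hmem]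

/-- The right-hand side depends on `B` only through its last factor. A singleton `S` propagates the
independence of the clocks; `S = Set.univ` yields the one-step probability. -/
theorem IsInput.measure_history_succ_inter (hξ : IsInput P lam mu ξ) (hlam : 0 < lam)
    (hmu : 0 < mu)
    (hclock : ∀ c B, MeasurableSet B →
      P (history t rule ξ y s N ∩ {ω | (randomSnapshot t rule ξ N ω).config = c} ∩
        {ω | (randomSnapshot t rule ξ N ω).clock ∈ B}) =
      P (history t rule ξ y s N ∩ {ω | (randomSnapshot t rule ξ N ω).config = c}) *
        clockLaw (eventRate lam mu) B)
    (S : Set (Config n k)) {B : Set (Event n → ℝ)} (hB : MeasurableSet B) :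
    P (history t rule ξ y s (N + 1) ∩ {ω | (randomSnapshot t rule ξ (N + 1) ω).config ∈ S} ∩
        {ω | (randomSnapshot t rule ξ (N + 1) ω).clock ∈ B}) =
      (∑' c, P (history t rule ξ y s N ∩ {ω | (randomSnapshot t rule ξ N ω).config = c}) *
        ∑ e ∈ Finset.insertNone c.busy, {e | (c.next t rule e).state t = y (N + 1) ∧
          c.next t rule e ∈ S}.indicator (fun e =>
            ENNReal.ofReal (Real.exp (-(c.totalRate lam mu * s N)) *
              (eventRate lam mu e / c.totalRate lam mu))) e) *
        clockLaw (eventRate lam mu) B := by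
  have hX (i : ℕ) := (measurable_randomSnapshot (t := t) (rule := rule) i
    fun j _ => hξ.measurable j)
  have hpast : ∀ i ≤ N, ∀ f, Measurable[pastClocks ξ N] (ξ i f) :=
    fun i hi f => measurable_pastClocks hi f
  refine (measure_eq_tsum_inter_fiber (t := t) (rule := rule) P hξ.measurable N _
    ((hξ.measurableSet_history.inter (measurableSet_config_mem
      (fun i _ => hξ.measurable i) S)).inter ((hX (N + 1)).2 hB))).trans ?_
  rw [← ENNReal.tsum_mul_right]
  refine tsum_congr fun c => ?_
  rw [mul_assoc, Finset.sum_mul, Finset.mul_sum,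
    ← Finset.sum_subset (Finset.subset_univ (Finset.insertNone c.busy))]
  · refine Finset.sum_congr rfl fun e he => ?_
    by_cases h : (c.next t rule e).state t = y (N + 1) ∧ c.next t rule e ∈ S
    · rw [Set.indicator_of_mem (show e ∈ {e | (c.next t rule e).state t = y (N + 1) ∧
        c.next t rule e ∈ S} from h), ← hξ.measure_fiber_step hlam hmu
        ((@MkMn.measurableSet_history n k t Ω rule ξ N y s (pastClocks ξ N) hpast).inter
          ((@measurable_randomSnapshot n k t Ω rule ξ (pastClocks ξ N) N hpast).1 c))
        (fun ω hω => hω.2) (hclock c) he (s N) hB]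
      congr 1
      ext ω
      simp only [history_succ, Set.mem_inter_iff, Set.mem_ofPred_eq]
      constructor
      · rintro ⟨⟨⟨⟨h1, h2, h3⟩, h4⟩, h5⟩, h6⟩
        exact ⟨⟨h1, h6.1⟩, h6.2, h2, h5⟩
      · rintro ⟨⟨h1, h2⟩, h3, h4, h5⟩
        have h6 : ω ∈ fiber t rule ξ N c e := ⟨h2, h3⟩
        rw [config_succ_of_mem_fiber h6]
        exact ⟨⟨⟨⟨h1, h4, h.1⟩, h.2⟩, h5⟩, h6⟩
    · rw [Set.indicator_of_notMem (show e ∉ {e | (c.next t rule e).state t = y (N + 1) ∧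
        c.next t rule e ∈ S} from h), zero_mul, mul_zero]
      refine (congrArg P ?_).trans (measure_empty (μ := P))
      refine Set.eq_empty_of_forall_notMem fun ω hω => h ?_
      obtain ⟨⟨hω1, hω2⟩, hω3⟩ := hω.1
      rw [← config_succ_of_mem_fiber hω.2]
      exact ⟨hω1.1 (N + 1) le_rfl, by assumption⟩
  -- A clock that is not running never fires.
  · intro e _ he
    refine (congrArg P ?_).trans (measure_empty (μ := P))
    refine Set.eq_empty_of_forall_notMem fun ω hω => he ?_
    rw [← hω.2.1, ← hω.2.2]
    exact (Snapshot.firing_mem_and_le _).1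

/-- Given the history, the clocks are independent and exponentially distributed. -/
theorem IsInput.measure_history_inter_clock (hξ : IsInput P lam mu ξ) (hlam : 0 < lam)
    (hmu : 0 < mu) (N : ℕ) (c : Config n k) (B : Set (Event n → ℝ)) (hB : MeasurableSet B) :
    P (history t rule ξ y s N ∩ {ω | (randomSnapshot t rule ξ N ω).config = c} ∩
        {ω | (randomSnapshot t rule ξ N ω).clock ∈ B}) =
      P (history t rule ξ y s N ∩ {ω | (randomSnapshot t rule ξ N ω).config = c}) *
        clockLaw (eventRate lam mu) B := by
  have hpos := eventRate_pos (n := n) hlam hmu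
  have hprob := isProbabilityMeasure_clockLaw hpos
  induction N generalizing c B with
  | zero =>
    have h : history t rule ξ y s 0 ∩ {ω | (randomSnapshot t rule ξ 0 ω).config = c} =
        {_ω | (⟨∅, []⟩ : Config n k).state t = y 0 ∧ (⟨∅, []⟩ : Config n k) = c} := by
      ext ω
      simp [history, randomSnapshot, snapshot]
    have hmap : P.map (fun ω f => ξ 0 f ω) B = clockLaw (eventRate lam mu) B := by
      rw [hξ.map_eq_clockLaw 0]
    rw [Measure.map_apply (measurable_pi_iff.2 fun f => hξ.measurable 0 f) hB] at hmap
    rw [h]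
    by_cases h0 : (⟨∅, []⟩ : Config n k).state t = y 0 ∧ (⟨∅, []⟩ : Config n k) = c
    · rw [Set.eq_univ_of_forall (s := {_ω : Ω | _}) fun _ => h0, Set.univ_inter, measure_univ,
        one_mul, ← hmap]
      rfl
    · simp [h0]
  | succ N ih =>
    have h := fun B hB => hξ.measure_history_succ_inter hlam hmu (B := B)
      (fun c B hB => ih c B hB) {c} hB
    -- Taking `B = Set.univ` identifies the infinite sum as the probability of the conditioning
    -- event.
    have h1 := h Set.univ MeasurableSet.univ
    simp only [Set.mem_univ, Set.ofPred_true, Set.inter_univ, measure_univ, mul_one] at h1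
    exact (h B hB).trans (congrArg (· * clockLaw (eventRate lam mu) B) h1.symm)

theorem generator_self_nonpos (hlam : 0 < lam) (hmu : 0 < mu) (x : QState k t) :
    generator n k t lam mu x x ≤ 0 := by
  have h (z : QState k t) : (if z = x then (1 : ℝ) else 0) - (if x = x then 1 else 0) ≤ 0 := by
    rw [if_pos rfl]
    split_ifs <;> norm_num
  exact add_nonpos (mul_nonpos_of_nonneg_of_nonpos hlam.le (h _))
    (mul_nonpos_of_nonneg_of_nonpos hmu.le (Finset.sum_nonpos fun i _ =>
      mul_nonpos_of_nonneg_of_nonpos (Nat.cast_nonneg _) (h _)))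

/-- Needed to make `ENNReal.ofReal` multiplicative on the product of transition factors. -/
theorem jumpMatrix_generator_nonneg (hlam : 0 < lam) (hmu : 0 < mu) (x z : QState k t) :
    0 ≤ jumpMatrix (generator n k t lam mu) x z := by
  have h : 0 ≤ exitRate (generator n k t lam mu) x :=
    neg_nonneg.2 (generator_self_nonpos hlam hmu x)
  unfold jumpMatrix
  split_ifs with h1 h2 h3
  · exact zero_le_one
  · exact le_rfl
  · exact le_rfl
  · exact div_nonneg ((isGenerator_generator hlam hmu).nonneg x z h3) h

theorem IsInput.measure_history_succ (hk : 1 ≤ k) (hξ : IsInput P lam mu ξ) (hlam : 0 < lam)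
    (hmu : 0 < mu) (N : ℕ) :
    P (history t rule ξ y s (N + 1)) = P (history t rule ξ y s N) *
      ENNReal.ofReal (Real.exp (-(exitRate (generator n k t lam mu) (y N) * s N)) *
        jumpMatrix (generator n k t lam mu) (y N) (y (N + 1))) := by
  have hprob := isProbabilityMeasure_clockLaw (eventRate_pos (n := n) hlam hmu)
  have h := hξ.measure_history_succ_inter hlam hmu
    (fun c B hB => hξ.measure_history_inter_clock (rule := rule) (y := y) (s := s)
      hlam hmu N c B hB) Set.univ MeasurableSet.univ
  simp only [Set.mem_univ, Set.ofPred_true, Set.inter_univ, measure_univ, mul_one, and_true] at h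
  have hX := (measurable_randomSnapshot (t := t) (rule := rule) N fun j _ => hξ.measurable j).1
  have hsum : P (history t rule ξ y s N) =
      ∑' c, P (history t rule ξ y s N ∩ {ω | (randomSnapshot t rule ξ N ω).config = c}) := by
    rw [← measure_iUnion]
    · rw [← Set.inter_iUnion]
      congr 1
      ext ω
      simp
    · intro c c' hne
      exact Set.disjoint_left.2 fun ω h1 h2 => hne (h1.2.symm.trans h2.2)
    · exact fun c => hξ.measurableSet_history.inter (hX c)
  rw [h, hsum, ← ENNReal.tsum_mul_right]
  refine tsum_congr fun c => ?_
  -- A configuration with a nonempty event occurs on some sample path, so it is `Good` and has the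
  -- reduced state `y N`. The others contribute zero.
  rcases Set.eq_empty_or_nonempty
    (history t rule ξ y s N ∩ {ω | (randomSnapshot t rule ξ N ω).config = c}) with h0 | ⟨ω, hω⟩
  · rw [h0, measure_empty, zero_mul, zero_mul]
  · have hc : c.Good t := hω.2 ▸ good_snapshot hk rule _ N
    have hy : c.state t = y N := by rw [← hω.2]; exact hω.1.1 N le_rfl
    have hnonneg (e : Event n) : 0 ≤ eventRate lam mu e / c.totalRate lam mu :=
      div_nonneg (eventRate_pos hlam hmu e).le (c.totalRate_pos hlam hmu).le
    congr 1
    rw [← hy, hc.exitRate_state hk rule, hc.jumpMatrix_state hk rule hlam hmu, Finset.mul_sum,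
      ENNReal.ofReal_sum_of_nonneg fun e _ => mul_nonneg (Real.exp_pos _).le (hnonneg e),
      Finset.sum_filter]
    refine Finset.sum_congr rfl fun e _ => ?_
    simp only [Set.indicator_apply, Set.mem_ofPred_eq]

theorem IsInput.measure_history (hk : 1 ≤ k) (hξ : IsInput P lam mu ξ) (hlam : 0 < lam)
    (hmu : 0 < mu) (N : ℕ) :
    P (history t rule ξ y s N) = ENNReal.ofReal ((if y 0 = (0, 0) then 1 else 0) *
      ∏ i ∈ Finset.range N, (Real.exp (-(exitRate (generator n k t lam mu) (y i) * (s i : ℝ))) *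
        jumpMatrix (generator n k t lam mu) (y i) (y (i + 1)))) := by
  induction N with
  | zero =>
    have h0 : (⟨∅, []⟩ : Config n k).state t = (0, 0) := rfl
    have h : history t rule ξ y s 0 = {_ω | y 0 = (0, 0)} := by
      ext ω
      simp [history, randomSnapshot, snapshot, h0, eq_comm]
    rw [h]
    by_cases hy : y 0 = (0, 0) <;> simp [hy]
  | succ N ih =>
    rw [hξ.measure_history_succ hk hlam hmu, ih, Finset.prod_range_succ, ← mul_assoc,
      ENNReal.ofReal_mul' (mul_nonneg (Real.exp_pos _).le
        (jumpMatrix_generator_nonneg hlam hmu _ _))]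

/-! ### From the jump chain to continuous time -/

theorem configAt_eq {ξ : ℕ → Event n → ℝ} {τ : ℝ≥0} {N : ℕ}
    (h1 : eventTime t rule ξ N ≤ τ) (h2 : τ < eventTime t rule ξ (N + 1)) :
    configAt t rule ξ τ = (snapshot t rule ξ N).config := by
  have h : IsGreatest {M | eventTime t rule ξ M ≤ τ} N := by
    refine ⟨h1, fun M hM => ?_⟩
    by_contra hlt
    have : eventTime t rule ξ (N + 1) ≤ eventTime t rule ξ M :=
      Finset.sum_le_sum_of_subset (Finset.range_subset_range.2 (by omega))
    exact absurd (this.trans hM) (not_le.2 h2)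
  rw [configAt, h.csSup_eq]

theorem IsInput.isMarkovChain (hk : 1 ≤ k) (hξ : IsInput P lam mu ξ) (hlam : 0 < lam)
    (hmu : 0 < mu) (rule : AssignmentRule n k) :
    IsMarkovChain P (generator n k t lam mu) (0, 0)
      (fun τ ω => (configAt t rule (fun i f => ξ i f ω) τ).state t) := by
  refine ⟨fun i ω => (randomSnapshot t rule ξ i ω).config.state t,
    fun i ω => ENNReal.ofReal (randomSnapshot t rule ξ i ω).holding, fun i y => ?_, fun i => ?_,
    fun N y s => ?_, ?_⟩
  · exact measurableSet_config_mem (fun j _ => hξ.measurable j) {c | c.state t = y}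
  · exact (measurable_holding fun j _ => hξ.measurable j).ennreal_ofReal
  · have h := hξ.measure_history (rule := rule) (y := y) (s := s) hk hlam hmu N
    have hset : {ω | (∀ i ≤ N, (randomSnapshot t rule ξ i ω).config.state t = y i) ∧
        ∀ i < N, (s i : ℝ≥0∞) < ENNReal.ofReal (randomSnapshot t rule ξ i ω).holding} =
        history t rule ξ y s N := by
      ext ω
      refine and_congr_right fun _ => forall₂_congr fun i _ => ?_
      rw [← ENNReal.ofReal_coe_nnreal, ENNReal.ofReal_lt_ofReal_iff']
      exact ⟨fun h => h.1, fun h => ⟨h, (s i).2.trans_lt h⟩⟩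
    rw [hset, h]
    -- The sides differ only in the decidability instance for `y 0 = (0, 0)`.
    congr
  · exact Filter.Eventually.of_forall fun ω N τ h1 h2 =>
      congrArg (Config.state t) (configAt_eq h1 h2)

end Markov

end MkMn

theorem mainTheorem3 (n k t : ℕ) (hk : 1 ≤ k) (hkn : k ≤ n)
    (lam mu : ℝ) (hlam : 0 < lam) (hmu : 0 < mu) :
    ∃ Q : Matrix (MkMn.QState k t) (MkMn.QState k t) ℝ,
      MkMn.IsQBD Q (MkMn.boundary n k t) (fun i => MkMn.level n k t (t + 1 + i))
        (fun i => MkMn.levelState n k t (t + 1 + i)) ∧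
      ∀ (rule : MkMn.AssignmentRule n k) (Ω : Type*) [MeasurableSpace Ω] (P : Measure Ω)
        [IsProbabilityMeasure P] (ξ : ℕ → MkMn.Event n → Ω → ℝ), MkMn.IsInput P lam mu ξ →
        MkMn.IsMarkovChain P Q (0, 0)
          (fun τ ω => (MkMn.configAt t rule (fun i f => ξ i f ω) τ).state t) :=
  ⟨MkMn.generator n k t lam mu, MkMn.isQBD_generator hk hkn hlam hmu,
    fun rule _ _ _ _ _ hξ => hξ.isMarkovChain hk hlam hmu rule⟩
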